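/- Let $N\ge 1$, let $\Omega\subset\mathbb R^N$ be a bounded open set of class $C^{0,1}$, and let $0<s'<s<1$. Here $\Omega$ is of class $C^{0,1}$ if there is $M>0$ such that every $x\in\partial\Omega$ has an open neighbourhood $U$ and a bijection $T$ of the cylinder $Q=\{(x',x_N)\in\mathbb R^{N-1}\times\mathbb R: |x'|<1,\ |x_N|<1\}$ onto $U$ such that $T$ and $T^{-1}$ are Lipschitz with constant $M$, $T(\{x\in Q: x_N>0\})=U\cap\Omega$ and $T(\{x\in Q: x_N=0\})=U\cap\partial\Omega$. Let $a:\overline\Omega\times\overline\Omega\times\mathbb R\to\mathbb R$ be such that for all $(x,y)\in\overline\Omega\times\overline\Omega$ the function $\varphi_{x,y}(t)=a(x,y,|t|)\,t$ for $t\ne0$, $\varphi_{x,y}(0)=0$, is an increasing homeomorphism of $\mathbb R$ onto itself; put $$\Phi_{x,y}(t)=\int_0^t\varphi_{x,y}(\tau)\,d\tau ,\qquad \widehat\Phi_x=\Phi_{x,x},$$ and assume that $(x,y)\mapsto\Phi_{x,y}(t)$ and $x\mapsto\widehat\Phi_x(t)$ are Lebesgue measurable for every $t\ge0$. Assume $$(\Phi_1)\qquad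 1<\varphi^-:=\inf_{x,y\in\overline\Omega,\ t>0}\frac{t\varphi_{x,y}(t)}{\Phi_{x,y}(t)}\ \le\ \varphi^+:=\sup_{x,y\in\overline\Omega,\ t>0}\frac{t\varphi_{x,y}(t)}{\Phi_{x,y}(t)}<\infty ,$$ and $\inf_{x,y\in\Omega}\Phi_{x,y}(1)>0$. Let $W^sL_{\Phi_{x,y}}(\Omega)$ be the space of all measurable $u:\Omega\to\mathbb R$ (modulo equality almost everywhere) such that $\int_\Omega\widehat\Phi_x(\lambda|u(x)|)\,dx<\infty$ for some $\lambda>0$ and $\int_\Omega\int_\Omega\Phi_{x,y}\big(\tfrac{\lambda|u(x)-u(y)|}{|x-y|^s}\big)\tfrac{dx\,dy}{|x-y|^N}<\infty$ for some $\lambda>0$, with the norm $$\|u\|_{s,\Phi_{x,y}}=\inf\Big\{\lambda>0:\int_\Omega\widehat\Phi_x\big(\tfrac{|u(x)|}{\lambda}\big)dx\le1\Big\}+\inf\Big\{\lambda>0:\int_\Omega\int_\Omega\Phi_{x,y}\big(\tfrac{|u(x)-u(y)|}{\lambda|x-y|^s}\big)\tfrac{dx\,dy}{|x-y|^N}\le1\Big\}.$$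 Set $\varphi^*_{s'}=\frac{N\varphi^-}{N-s'\varphi^-}$ if $s'\varphi^-<N$ and $\varphi^*_{s'}=\infty$ otherwise. Then: - if $s'\varphi^-<N$, then $W^sL_{\Phi_{x,y}}(\Omega)$ embeds continuously into $L^q(\Omega)$ for all $q\in[1,\varphi^*_{s'}]$, and compactly for all $q\in[1,\varphi^*_{s'})$; - if $s'\varphi^-=N$, then $W^sL_{\Phi_{x,y}}(\Omega)$ embeds continuously into $L^q(\Omega)$ for all $q\in[1,\infty]$, and compactly for all $q\in[1,\infty)$; - if $s'\varphi^->N$, then $W^sL_{\Phi_{x,y}}(\Omega)$ embeds compactly into $L^\infty(\Omega)$. -/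

import Mathlib

open MeasureTheory Set Filter Topology
open scoped ENNReal NNReal

noncomputable section

namespace FracMusielak

/-- Euclidean space `ℝ^N`. -/
abbrev E (N : ℕ) : Type := EuclideanSpace ℝ (Fin N)

/-! ### Domains with Lipschitz boundary -/

/-- The open cylinder `{(x', x_N) : |x'| < 1, |x_N| < 1}` in `ℝ^(N-1) × ℝ`. -/
def cyl (N : ℕ) : Set (E (N - 1) × ℝ) := {z | ‖z.1‖ < 1 ∧ |z.2| < 1}

/-- The upper half `{0 < x_N}` of the cylinder. -/
def cylPos (N : ℕ) : Set (E (N - 1) × ℝ) := {z | z ∈ cyl N ∧ 0 < z.2}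

/-- The middle section `{x_N = 0}` of the cylinder. -/
def cylZero (N : ℕ) : Set (E (N - 1) × ℝ) := {z | z ∈ cyl N ∧ z.2 = 0}

/-- `Ω` is of class `C^{0,1}` (for `N ≥ 1`): there is a constant `M` such that every boundary
point has an open neighbourhood `U` which is the image of the cylinder under a bijection `T` that
is Lipschitz with Lipschitz inverse `T'`, both with constant `M`, and that carries the upper half
of the cylinder onto `U ∩ Ω` and its middle section onto `U ∩ ∂Ω`. -/
def IsLipschitzDomain {N : ℕ} (Ω : Set (E N)) : Prop :=
  ∃ M : ℝ≥0, ∀ x ∈ frontier Ω, ∃ U : Set (E N), IsOpen U ∧ x ∈ U ∧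
    ∃ (T : E (N - 1) × ℝ → E N) (T' : E N → E (N - 1) × ℝ),
      InvOn T' T (cyl N) U ∧ T '' cyl N = U ∧
      LipschitzOnWith M T (cyl N) ∧ LipschitzOnWith M T' U ∧
      T '' cylPos N = U ∩ Ω ∧ T '' cylZero N = U ∩ frontier Ω

/-! ### Musielak functions -/

/-- `φ_{x,y}(t) = a(x,y,|t|) t` for `t ≠ 0`, and `φ_{x,y}(0) = 0`. -/
def phi {N : ℕ} (a : E N → E N → ℝ → ℝ) (x y : E N) (t : ℝ) : ℝ :=
  if t = 0 then 0 else a x y |t| * t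

/-- `Φ_{x,y}(t) = ∫_0^t φ_{x,y}(τ) dτ`. -/
def Phi {N : ℕ} (a : E N → E N → ℝ → ℝ) (x y : E N) (t : ℝ) : ℝ :=
  ∫ τ in (0 : ℝ)..t, phi a x y τ

/-- The standing assumptions: for all `x, y` in the closure of `Ω` the function `φ_{x,y}` is an
increasing homeomorphism of `ℝ` onto itself, and for every `t ≥ 0` the functions
`(x, y) ↦ Φ_{x,y}(t)` and `x ↦ Φ_{x,x}(t)` are Lebesgue measurable, so that `Φ_{x,y}` and
`Φ_{x,x}` are Musielak functions. -/
structure IsMusielak {N : ℕ} (Ω : Set (E N)) (a : E N → E N → ℝ → ℝ) : Prop where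
  strictMono : ∀ x ∈ closure Ω, ∀ y ∈ closure Ω, StrictMono (phi a x y)
  isHomeomorph : ∀ x ∈ closure Ω, ∀ y ∈ closure Ω, IsHomeomorph (phi a x y)
  measurable : ∀ t : ℝ, 0 ≤ t → AEMeasurable (fun z : E N × E N => Phi a z.1 z.2 t)
    ((volume : Measure (E N × E N)).restrict (closure Ω ×ˢ closure Ω))
  measurable_diag : ∀ t : ℝ, 0 ≤ t → AEMeasurable (fun x : E N => Phi a x x t)
    ((volume : Measure (E N)).restrict (closure Ω))

/-- All values `t φ_{x,y}(t) / Φ_{x,y}(t)` with `x, y` in the closure of `Ω` and `t > 0`. -/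
def growthSet {N : ℕ} (Ω : Set (E N)) (a : E N → E N → ℝ → ℝ) : Set ℝ :=
  {r | ∃ x ∈ closure Ω, ∃ y ∈ closure Ω, ∃ t : ℝ, 0 < t ∧ r = t * phi a x y t / Phi a x y t}

/-- The lower growth exponent `φ⁻`. -/
def phiMinus {N : ℕ} (Ω : Set (E N)) (a : E N → E N → ℝ → ℝ) : ℝ := sInf (growthSet Ω a)

/-- The condition `1 < φ⁻ ≤ φ⁺ < ∞`, where `φ⁺` is the supremum of `growthSet Ω a`. -/
def GrowthCondition {N : ℕ} (Ω : Set (E N)) (a : E N → E N → ℝ → ℝ) : Prop :=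
  1 < phiMinus Ω a ∧ BddAbove (growthSet Ω a)

/-! ### The fractional Musielak-Sobolev space -/

/-- The modular `∫_Ω Φ_{x,x}(|u(x)|) dx`. -/
def modular {N : ℕ} (Ω : Set (E N)) (a : E N → E N → ℝ → ℝ) (u : E N → ℝ) : ℝ≥0∞ :=
  ∫⁻ x in Ω, ENNReal.ofReal (Phi a x x |u x|)

/-- The modular `∫_Ω ∫_Ω Φ_{x,y}(|u(x) - u(y)| / |x - y|^s) |x - y|^{-N} dx dy`. -/
def gagliardoModular {N : ℕ} (Ω : Set (E N)) (a : E N → E N → ℝ → ℝ) (s : ℝ) (u : E N → ℝ) :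
    ℝ≥0∞ :=
  ∫⁻ x in Ω, ∫⁻ y in Ω,
    ENNReal.ofReal (Phi a x y (|u x - u y| / ‖x - y‖ ^ s) / ‖x - y‖ ^ N)

/-- `u` (a function whose values outside `Ω` are irrelevant) belongs to the fractional
Musielak-Sobolev space `W^s L_{Φ_{x,y}}(Ω)`. -/
def MemW {N : ℕ} (Ω : Set (E N)) (a : E N → E N → ℝ → ℝ) (s : ℝ) (u : E N → ℝ) : Prop :=
  AEStronglyMeasurable u (volume.restrict Ω) ∧
  (∃ l : ℝ, 0 < l ∧ modular Ω a (fun x => l * u x) < ∞) ∧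
  (∃ l : ℝ, 0 < l ∧ gagliardoModular Ω a s (fun x => l * u x) < ∞)

/-- The Luxemburg norm of the Musielak space with Musielak function `Φ_{x,x}`. -/
def luxNorm {N : ℕ} (Ω : Set (E N)) (a : E N → E N → ℝ → ℝ) (u : E N → ℝ) : ℝ :=
  sInf {l : ℝ | 0 < l ∧ modular Ω a (fun x => u x / l) ≤ 1}

/-- The Gagliardo seminorm `[u]_{s,Φ_{x,y}}`. -/
def gagliardoSeminorm {N : ℕ} (Ω : Set (E N)) (a : E N → E N → ℝ → ℝ) (s : ℝ) (u : E N → ℝ) : ℝ :=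
  sInf {l : ℝ | 0 < l ∧ gagliardoModular Ω a s (fun x => u x / l) ≤ 1}

/-- The norm of `W^s L_{Φ_{x,y}}(Ω)`. -/
def normW {N : ℕ} (Ω : Set (E N)) (a : E N → E N → ℝ → ℝ) (s : ℝ) (u : E N → ℝ) : ℝ :=
  luxNorm Ω a u + gagliardoSeminorm Ω a s u

/-! ### Embeddings into Lebesgue spaces -/

/-- `W^s L_{Φ_{x,y}}(Ω)` is continuously embedded in `L^q(Ω)`. -/
def ContinuouslyEmbedded {N : ℕ} (Ω : Set (E N)) (a : E N → E N → ℝ → ℝ) (s : ℝ) (q : ℝ≥0∞) :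
    Prop :=
  ∃ C : ℝ, 0 ≤ C ∧ ∀ u : E N → ℝ, MemW Ω a s u →
    MemLp u q (volume.restrict Ω) ∧
    eLpNorm u q (volume.restrict Ω) ≤ ENNReal.ofReal (C * normW Ω a s u)

/-- `W^s L_{Φ_{x,y}}(Ω)` is compactly embedded in `L^q(Ω)`: the embedding is continuous, and every
bounded sequence has a subsequence that converges in `L^q(Ω)`. -/
def CompactlyEmbedded {N : ℕ} (Ω : Set (E N)) (a : E N → E N → ℝ → ℝ) (s : ℝ) (q : ℝ≥0∞) :
    Prop :=
  ContinuouslyEmbedded Ω a s q ∧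
  ∀ u : ℕ → E N → ℝ, (∀ n, MemW Ω a s (u n)) → (∃ R : ℝ, ∀ n, normW Ω a s (u n) ≤ R) →
    ∃ (v : E N → ℝ) (k : ℕ → ℕ), MemLp v q (volume.restrict Ω) ∧ StrictMono k ∧
      Tendsto (fun n => eLpNorm (fun x => u (k n) x - v x) q (volume.restrict Ω)) atTop (𝓝 0)

/-- The critical exponent `φ*_{s'}`, equal to `N φ⁻ / (N - s' φ⁻)` if `s' φ⁻ < N` and to `∞`
otherwise. -/
def critExp {N : ℕ} (Ω : Set (E N)) (a : E N → E N → ℝ → ℝ) (s' : ℝ) : ℝ≥0∞ :=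
  if s' * phiMinus Ω a < N then
    ENNReal.ofReal (N * phiMinus Ω a / (N - s' * phiMinus Ω a))
  else ∞

end FracMusielak

end

/-! Write p for φ⁻. The lower growth bound gives t^p ≤ 1 + Φ_{x,y}(t)/c, uniformly in x and y. For σ
< s the modulars therefore control the classical Gagliardo energy of order σ and exponent p: the
constant 1 contributes |x - y|^((s-σ)p - N), which is integrable on a bounded set exactly because σ
< s (`gagKernel_le_of_modular`, `exists_energy_bound`). This reduces everything to the space
W^{σ,p}.

The Lipschitz boundary enters only through the measure density |Ω ∩ B(x,r)| ≥ c r^N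
(`exists_measure_density`). Comparing u(x) with its mean over Ω ∩ B(x,r) and choosing r according to
the Gagliardo density at x improves integrability from q to p + (σp/N)q. This map contracts to the
critical exponent Np/(N - σp), so every smaller exponent is reached (`Ehrling.bootstrap`). If σp >
N, means over dyadic balls telescope to an L^∞ bound (`ehrling_top`). Both results take the form
‖u‖_q ≤ ε + C‖u‖₁ for energy at most 1.

The L¹ norm is in turn controlled, up to ε, by finitely many means. A diagonal subsequence makes all
means converge, and the sequence is then Cauchy in L^q (`Ehrling.exists_subseq_tendsto`).

If s'p ≤ N, some σ strictly between s' and s makes the exponents allowed for s' subcritical for σ,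
so the embedding is compact even at the endpoint. -/

noncomputable section

/-! ### Lipschitz charts and the measure density condition. -/

namespace FracMusielak

/-- Every point of the half cylinder is the tip of inscribed balls of comparable radius. -/
theorem exists_ball_subset_cylPos {N : ℕ} {z : E (N - 1) × ℝ} (hz : z ∈ cylPos N) {t : ℝ}
    (ht : 0 < t) (ht1 : t ≤ 1) :
    ∃ w : E (N - 1) × ℝ, Metric.ball w (t / 2) ⊆ cylPos N ∧ dist w z ≤ t := by
  obtain ⟨⟨h1, h2⟩, h3⟩ := hz
  rw [abs_lt] at h2
  -- Contracting towards the origin frees a margin t at the lateral wall and the lid; the lift by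
  -- t/2 centres the ball between the flat bottom and the lid.
  refine ⟨((1 - t) • z.1, (1 - t) * z.2 + t / 2), ?_, ?_⟩
  · intro y hy
    rw [Metric.mem_ball, Prod.dist_eq, max_lt_iff] at hy
    obtain ⟨ha, hb⟩ := hy
    rw [Real.dist_eq, abs_lt] at hb
    rw [dist_eq_norm] at ha
    simp only at ha hb
    refine ⟨⟨?_, ?_⟩, ?_⟩
    · calc ‖y.1‖ ≤ ‖y.1 - (1 - t) • z.1‖ + ‖(1 - t) • z.1‖ := by
            simpa using norm_add_le (y.1 - (1 - t) • z.1) ((1 - t) • z.1)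
        _ < 1 := by
            rw [norm_smul, Real.norm_eq_abs, abs_of_nonneg (by linarith)]
            nlinarith
    · rw [abs_lt]; constructor <;> nlinarith
    · nlinarith
  · rw [Prod.dist_eq]
    refine max_le ?_ ?_
    · rw [dist_eq_norm]
      have : (1 - t) • z.1 - z.1 = (-t) • z.1 := by rw [sub_smul, one_smul, neg_smul]; abel
      simp only [this, norm_smul, norm_neg, Real.norm_eq_abs, abs_of_pos ht]
      nlinarith
    · rw [Real.dist_eq, abs_le]
      simp only
      constructor <;> nlinarith

/-- A Lipschitz domain contains balls of comparable radius near each of its points, locally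
uniformly on the closure. -/
theorem local_corkscrew {N : ℕ} {Ω : Set (E N)} (ho : IsOpen Ω) {M : ℝ} (hM : 1 ≤ M)
    {x₀ : E N}
    (hchart : x₀ ∈ frontier Ω → ∃ U : Set (E N), IsOpen U ∧ x₀ ∈ U ∧
      ∃ (T : E (N - 1) × ℝ → E N) (T' : E N → E (N - 1) × ℝ),
      InvOn T' T (cyl N) U ∧ T '' cyl N = U ∧
      LipschitzOnWith M.toNNReal T (cyl N) ∧ LipschitzOnWith M.toNNReal T' U ∧
      T '' cylPos N = U ∩ Ω)
    (hx₀ : x₀ ∈ closure Ω) :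
    ∃ δ : ℝ, 0 < δ ∧ ∀ x ∈ Ω, dist x x₀ < δ → ∀ r : ℝ, 0 < r → r ≤ δ →
      ∃ y, Metric.ball y (r / (8 * M ^ 2)) ⊆ Ω ∩ Metric.ball x r := by
  have hM2 : (1 : ℝ) ≤ M ^ 2 := by nlinarith
  by_cases hx : x₀ ∈ Ω
  · obtain ⟨δ, hδ, hball⟩ := Metric.isOpen_iff.1 ho x₀ hx
    refine ⟨δ / 2, by positivity, fun x _ hxx r hr hrδ => ⟨x, ?_⟩⟩
    have h1 : r / (8 * M ^ 2) ≤ r := div_le_self hr.le (by linarith)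
    refine subset_inter (fun y hy => hball ?_) (Metric.ball_subset_ball h1)
    rw [Metric.mem_ball] at *
    linarith [dist_triangle y x x₀]
  · obtain ⟨U, hU, hxU, T, T', hinv, hTU, hT, hT', hpos⟩ :=
      hchart ⟨hx₀, by rwa [ho.interior_eq]⟩
    obtain ⟨δ, hδ, hball⟩ := Metric.isOpen_iff.1 hU x₀ hxU
    have hMc : (M.toNNReal : ℝ) = M := Real.coe_toNNReal _ (by linarith)
    have hM0 : 0 < M := by linarith
    -- The quarter keeps B(x, r) inside U, where the inverse chart is available; the bound 1 makes
    -- the parameter t below admissible.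
    refine ⟨min (δ / 4) 1, by positivity, fun x hxΩ hxx r hr hrδ => ?_⟩
    have hr1 : r ≤ δ / 4 := hrδ.trans (min_le_left _ _)
    have hr2 : r ≤ 1 := hrδ.trans (min_le_right _ _)
    have hxx' : dist x x₀ < δ / 4 := hxx.trans_le (min_le_left _ _)
    have hxU' : x ∈ U ∩ Ω := ⟨hball (by rw [Metric.mem_ball]; linarith), hxΩ⟩
    rw [← hpos] at hxU'
    obtain ⟨z, hz, rfl⟩ := hxU'
    -- With t = r/(2M) the chart moves the centre by at most r/2, and the inverse chart sends a ball
    -- of radius r/(8M²) into one of radius r/(8M) ≤ t/2.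
    obtain ⟨w, hw, hwz⟩ := exists_ball_subset_cylPos hz (t := r / (2 * M)) (by positivity)
      (by rw [div_le_one (by positivity)]; linarith)
    have hwP : w ∈ cylPos N := hw (Metric.mem_ball_self (by positivity))
    have hd : dist (T w) (T z) ≤ r / 2 := by
      have := hT.dist_le_mul w hwP.1 z hz.1
      rw [hMc] at this
      calc _ ≤ M * dist w z := this
        _ ≤ M * (r / (2 * M)) := by gcongr
        _ = r / 2 := by field_simp
    have h8 : r / (8 * M ^ 2) ≤ r / 8 := by
      gcongr; linarith
    refine ⟨T w, fun y hy => ?_⟩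
    rw [Metric.mem_ball] at hy
    have hyx : dist y (T z) < r := by linarith [dist_triangle y (T w) (T z)]
    have hyU : y ∈ U := hball (by
      rw [Metric.mem_ball]; linarith [dist_triangle y (T z) x₀])
    have hwU : T w ∈ U := hTU ▸ mem_image_of_mem T hwP.1
    have hyP : T' y ∈ cylPos N := by
      apply hw
      rw [Metric.mem_ball]
      have := hT'.dist_le_mul y hyU (T w) hwU
      rw [hMc, hinv.1 hwP.1] at this
      calc _ ≤ M * dist y (T w) := this
        _ < M * (r / (8 * M ^ 2)) := by gcongr
        _ ≤ r / (2 * M) / 2 := by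
          rw [show M * (r / (8 * M ^ 2)) = r / (8 * M) by field_simp,
            show r / (2 * M) / 2 = r / (4 * M) by ring]
          gcongr
          norm_num
    have : y ∈ U ∩ Ω := by
      rw [← hpos, ← hinv.2 hyU]; exact mem_image_of_mem T hyP
    exact ⟨this.2, hyx⟩

/-- A bounded Lipschitz domain satisfies the measure density condition. -/
theorem IsLipschitzDomain.exists_measure_density {N : ℕ} {Ω : Set (E N)} (ho : IsOpen Ω)
    (hb : Bornology.IsBounded Ω) (hl : IsLipschitzDomain Ω) :
    ∃ c : ℝ≥0, 0 < c ∧ ∀ x ∈ Ω, ∀ r : ℝ≥0, 0 < r → r ≤ 1 →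
      (c * r ^ N : ℝ≥0∞) ≤ volume (Ω ∩ Metric.ball x r) := by
  obtain ⟨M₀, hM₀⟩ := hl
  set M : ℝ := max 1 M₀ with hMdef
  have hM : 1 ≤ M := le_max_left _ _
  have hMM : M₀ ≤ M.toNNReal := by
    rw [← NNReal.coe_le_coe, Real.coe_toNNReal _ (by linarith)]; exact le_max_right _ _
  have hloc : ∀ x₀ ∈ closure Ω, ∃ δ : ℝ, 0 < δ ∧ ∀ x ∈ Ω, dist x x₀ < δ →
      ∀ r : ℝ, 0 < r → r ≤ δ → ∃ y, Metric.ball y (r / (8 * M ^ 2)) ⊆ Ω ∩ Metric.ball x r := by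
    intro x₀ hx₀
    refine local_corkscrew ho hM (fun hf => ?_) hx₀
    obtain ⟨U, hU, hxU, T, T', h1, h2, h3, h4, h5, -⟩ := hM₀ x₀ hf
    exact ⟨U, hU, hxU, T, T', h1, h2, h3.weaken hMM, h4.weaken hMM, h5⟩
  have hK : IsCompact (closure Ω) := hb.isCompact_closure
  obtain ⟨δ, hδ, hδr⟩ : ∃ δ : ℝ, 0 < δ ∧ ∀ x ∈ Ω, x ∈ closure Ω →
      ∀ r : ℝ, 0 < r → r ≤ δ → ∃ y, Metric.ball y (r / (8 * M ^ 2)) ⊆ Ω ∩ Metric.ball x r := by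
    refine hK.induction_on (p := fun s => ∃ δ : ℝ, 0 < δ ∧ ∀ x ∈ Ω, x ∈ s →
      ∀ r : ℝ, 0 < r → r ≤ δ → ∃ y, Metric.ball y (r / (8 * M ^ 2)) ⊆ Ω ∩ Metric.ball x r)
      ⟨1, one_pos, by simp⟩ ?_ ?_ ?_
    · rintro s t hst ⟨δ, hδ, h⟩
      exact ⟨δ, hδ, fun x hx hxs => h x hx (hst hxs)⟩
    · rintro s t ⟨δ, hδ, h⟩ ⟨δ', hδ', h'⟩
      refine ⟨min δ δ', by positivity, fun x hx hxs r hr hrδ => ?_⟩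
      rcases hxs with hxs | hxs
      · exact h x hx hxs r hr (hrδ.trans (min_le_left _ _))
      · exact h' x hx hxs r hr (hrδ.trans (min_le_right _ _))
    · intro x₀ hx₀
      obtain ⟨δ, hδ, h⟩ := hloc x₀ hx₀
      exact ⟨Metric.ball x₀ δ, mem_nhdsWithin_of_mem_nhds (Metric.ball_mem_nhds _ hδ), δ, hδ,
        fun x hx hxs => h x hx hxs⟩
  -- Density is wanted for all r ≤ 1, but inscribed balls exist only up to radius δ; working at
  -- radius ρr costs only a factor in the constant.
  set ρ : ℝ := min δ 1 with hρ
  have hρ0 : 0 < ρ := by positivity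
  set k : ℝ≥0 := (ρ / (8 * M ^ 2)).toNNReal with hk
  have hk0 : 0 < k := Real.toNNReal_pos.2 (by positivity)
  set v : ℝ≥0 := (volume (Metric.ball (0 : E N) 1)).toNNReal with hv
  have hvc : (v : ℝ≥0∞) = volume (Metric.ball (0 : E N) 1) :=
    ENNReal.coe_toNNReal measure_ball_lt_top.ne
  have hv0 : 0 < v := by
    rw [← ENNReal.coe_pos, hvc]; exact Metric.measure_ball_pos _ _ one_pos
  refine ⟨v * k ^ N, by positivity, fun x hx r hr hr1 => ?_⟩
  have hr1' : (r : ℝ) ≤ 1 := hr1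
  obtain ⟨y, hy⟩ := hδr x hx (subset_closure hx) (ρ * r) (by positivity)
    (by calc ρ * r ≤ ρ * 1 := by gcongr
          _ ≤ δ := by rw [mul_one]; exact min_le_left _ _)
  have hball : Metric.ball x (ρ * r) ⊆ Metric.ball x r := Metric.ball_subset_ball (by
    calc ρ * r ≤ 1 * r := by gcongr; exact min_le_right _ _
      _ = r := one_mul _)
  calc ((v * k ^ N : ℝ≥0) * r ^ N : ℝ≥0∞)
      = volume (Metric.ball y (ρ * r / (8 * M ^ 2))) := by
        rw [Measure.addHaar_ball_of_pos _ _ (by positivity), ← hvc,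
          show ρ * r / (8 * M ^ 2) = ((k * r : ℝ≥0) : ℝ) by
            rw [NNReal.coe_mul, hk, Real.coe_toNNReal _ (by positivity)]; ring,
          ← NNReal.coe_pow, ENNReal.ofReal_coe_nnreal]
        simp only [finrank_euclideanSpace, Fintype.card_fin]
        push_cast
        ring
    _ ≤ _ := measure_mono (hy.trans (inter_subset_inter_right _ hball))

end FracMusielak

end

/-! ### From Musielak modulars to a classical Gagliardo energy. -/

noncomputable section

namespace FracMusielak

/-! ### Primitives of increasing functions -/

section Primitive

variable {f : ℝ → ℝ}

theorem primitive_nonneg (hm : StrictMono f) (h0 : f 0 = 0) {t : ℝ} (ht : 0 ≤ t) :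
    0 ≤ ∫ τ in (0 : ℝ)..t, f τ :=
  intervalIntegral.integral_nonneg ht fun _ hx => h0 ▸ hm.monotone hx.1

theorem primitive_pos (hf : Continuous f) (hm : StrictMono f) (h0 : f 0 = 0) {t : ℝ}
    (ht : 0 < t) : 0 < ∫ τ in (0 : ℝ)..t, f τ :=
  intervalIntegral.intervalIntegral_pos_of_pos_on (hf.intervalIntegrable _ _)
    (fun _ hx => h0 ▸ hm hx.1) ht

/-- Substitute τ ↦ τ/k and use monotonicity. This form of convexity is all that the Luxemburg norms
require. -/
theorem primitive_div_le (hf : Continuous f) (hm : StrictMono f) {t k : ℝ}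
    (ht : 0 ≤ t) (hk : 1 ≤ k) :
    ∫ τ in (0 : ℝ)..(t / k), f τ ≤ (∫ τ in (0 : ℝ)..t, f τ) / k := by
  have hk0 : 0 < k := by linarith
  have h := intervalIntegral.integral_comp_div (a := 0) (b := t) f hk0.ne'
  rw [zero_div, smul_eq_mul] at h
  rw [le_div_iff₀ hk0, mul_comm, ← h]
  refine intervalIntegral.integral_mono_on ht
    ((hf.comp (continuous_id.div_const k)).intervalIntegrable _ _)
    (hf.intervalIntegrable _ _) fun x hx => hm.monotone (div_le_self hx.1 hk)

/-- The growth hypothesis says that F(r) r^(-p) has nonnegative derivative (r f(r) - pF(r))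
r^(-p-1). -/
theorem primitive_one_mul_rpow_le (hf : Continuous f) {p : ℝ}
    (hgrow : ∀ t : ℝ, 0 < t → p * (∫ τ in (0 : ℝ)..t, f τ) ≤ t * f t) {t : ℝ} (ht : 1 ≤ t) :
    (∫ τ in (0 : ℝ)..1, f τ) * t ^ p ≤ ∫ τ in (0 : ℝ)..t, f τ := by
  set F : ℝ → ℝ := fun t => ∫ τ in (0 : ℝ)..t, f τ with hF
  have hd : ∀ r : ℝ, 0 < r → HasDerivAt (fun r => F r * r ^ (-p))
      (f r * r ^ (-p) + F r * (-p * r ^ (-p - 1))) r := fun r hr =>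
    ((hf.integral_hasStrictDerivAt 0 r).hasDerivAt).mul
      (Real.hasDerivAt_rpow_const (Or.inl hr.ne'))
  have hmono : MonotoneOn (fun r => F r * r ^ (-p)) (Ici 1) := by
    refine monotoneOn_of_deriv_nonneg (convex_Ici 1)
      (fun r hr => (hd r (by linarith [mem_Ici.1 hr])).continuousAt.continuousWithinAt)
      (fun r hr => ?_) (fun r hr => ?_)
    · rw [interior_Ici] at hr
      exact (hd r (by linarith [mem_Ioi.1 hr])).differentiableAt.differentiableWithinAt
    · rw [interior_Ici] at hr
      have hr0 : 0 < r := by linarith [mem_Ioi.1 hr]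
      rw [(hd r hr0).deriv]
      have h1 : r ^ (-p) = r * r ^ (-p - 1) := by
        rw [Real.rpow_sub_one hr0.ne']; field_simp
      have : f r * r ^ (-p) + F r * (-p * r ^ (-p - 1)) = (r * f r - p * F r) * r ^ (-p - 1) := by
        rw [h1]; ring
      rw [this]
      exact mul_nonneg (sub_nonneg.2 (hgrow r hr0)) (Real.rpow_nonneg hr0.le _)
  have h := hmono (mem_Ici.2 le_rfl) (mem_Ici.2 ht) ht
  simp only [Real.one_rpow, mul_one] at h
  have ht0 : 0 < t := by linarith
  calc F 1 * t ^ p ≤ F t * t ^ (-p) * t ^ p := by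
        gcongr
    _ = F t := by rw [mul_assoc, ← Real.rpow_add ht0]; simp

end Primitive

/-! ### Consequences for the Musielak function -/

variable {N : ℕ} {Ω : Set (E N)} {a : E N → E N → ℝ → ℝ}

theorem IsMusielak.Phi_nonneg (ha : IsMusielak Ω a) {x y : E N} (hx : x ∈ Ω) (hy : y ∈ Ω) {t : ℝ}
    (ht : 0 ≤ t) : 0 ≤ Phi a x y t :=
  primitive_nonneg (ha.strictMono x (subset_closure hx) y (subset_closure hy)) (by simp [phi]) ht

theorem IsMusielak.Phi_div_le (ha : IsMusielak Ω a) {x y : E N} (hx : x ∈ Ω) (hy : y ∈ Ω)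
    {t k : ℝ} (ht : 0 ≤ t) (hk : 1 ≤ k) : Phi a x y (t / k) ≤ Phi a x y t / k :=
  primitive_div_le (ha.isHomeomorph x (subset_closure hx) y (subset_closure hy)).continuous
    (ha.strictMono x (subset_closure hx) y (subset_closure hy)) ht hk

/-- The lower growth exponent gives polynomial growth of the Musielak function. -/
theorem IsMusielak.rpow_le (ha : IsMusielak Ω a) (hg : GrowthCondition Ω a) {c : ℝ} (hc : 0 < c)
    {x y : E N} (hx : x ∈ Ω) (hy : y ∈ Ω) (hcx : c ≤ Phi a x y 1) {t : ℝ} (ht : 0 ≤ t) :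
    t ^ phiMinus Ω a ≤ 1 + Phi a x y t / c := by
  have hp : 0 ≤ phiMinus Ω a := by linarith [hg.1]
  have hx' := subset_closure hx
  have hy' := subset_closure hy
  have hcont := (ha.isHomeomorph x hx' y hy').continuous
  have hmono := ha.strictMono x hx' y hy'
  have hzero : ∀ x y, phi a x y 0 = 0 := by simp [phi]
  rcases le_total t 1 with h1 | h1
  · have h2 := Real.rpow_le_one ht h1 hp
    have h3 : 0 ≤ Phi a x y t / c := div_nonneg (ha.Phi_nonneg hx hy ht) hc.le
    linarith
  · have hgrow : ∀ t : ℝ, 0 < t → phiMinus Ω a * Phi a x y t ≤ t * phi a x y t := by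
      intro t ht
      have hpos : 0 < Phi a x y t := primitive_pos hcont hmono (hzero _ _) ht
      rw [← le_div_iff₀ hpos]
      -- A real infimum bounds its set only if the set is bounded below; here the ratios are
      -- nonnegative.
      refine csInf_le ⟨0, ?_⟩ ⟨x, hx', y, hy', t, ht, rfl⟩
      rintro r ⟨x', hx'', y', hy'', t', ht', rfl⟩
      have h0 : 0 ≤ phi a x' y' t' := hzero x' y' ▸ (ha.strictMono x' hx'' y' hy'').monotone ht'.le
      exact div_nonneg (mul_nonneg ht'.le h0)
        (primitive_nonneg (ha.strictMono x' hx'' y' hy'') (hzero _ _) ht'.le)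
    have h2 : Phi a x y 1 * t ^ phiMinus Ω a ≤ Phi a x y t :=
      primitive_one_mul_rpow_le hcont hgrow h1
    have h3 : c * t ^ phiMinus Ω a ≤ Phi a x y t :=
      (mul_le_mul_of_nonneg_right hcx (Real.rpow_nonneg ht _)).trans h2
    have h4 : t ^ phiMinus Ω a ≤ Phi a x y t / c := by
      rw [le_div_iff₀ hc]; linarith
    linarith

/-! ### The classical Gagliardo energy -/

/-- The integrand `|u(x) - u(y)|^p / |x - y|^(N + σ p)` of the Gagliardo energy. -/
def gagKernel {N : ℕ} (p σ : ℝ) (u : E N → ℝ) (x y : E N) : ℝ≥0∞ :=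
  ‖u x - u y‖ₑ ^ p / ‖x - y‖ₑ ^ (N + σ * p)

/-- The partial energy `∫_Ω |u(x) - u(y)|^p / |x - y|^(N + σ p) dy`. -/
def gagDensity {N : ℕ} (Ω : Set (E N)) (p σ : ℝ) (u : E N → ℝ) (x : E N) : ℝ≥0∞ :=
  ∫⁻ y in Ω, gagKernel p σ u x y

/-- The Gagliardo energy of order `σ` and exponent `p`. -/
def gagEnergy {N : ℕ} (Ω : Set (E N)) (p σ : ℝ) (u : E N → ℝ) : ℝ≥0∞ :=
  ∫⁻ x in Ω, gagDensity Ω p σ u x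

theorem gagKernel_self {p : ℝ} (hp : 0 < p) (σ : ℝ) (u : E N → ℝ) (x : E N) :
    gagKernel p σ u x x = 0 := by
  simp [gagKernel, hp]

/-- With d = |x - y| and t = |u(x) - u(y)|/d^s, the kernel equals t^p d^((s-σ)p - N). Inserting t^p
≤ 1 + Φ(t)/c leaves a pure power of d and the modular integrand, whose surplus factor d^((s-σ)p) is
at most its value at D. -/
theorem gagKernel_le_of_modular {s σ D c : ℝ} (hσs : σ < s)
    (ha : IsMusielak Ω a) (hg : GrowthCondition Ω a) (hc : 0 < c)
    (hcx : ∀ x ∈ Ω, ∀ y ∈ Ω, c ≤ Phi a x y 1) (u : E N → ℝ) {x y : E N} (hx : x ∈ Ω) (hy : y ∈ Ω)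
    (hD : ‖x - y‖ ≤ D) :
    gagKernel (phiMinus Ω a) σ u x y ≤
      ENNReal.ofReal (‖x - y‖ ^ ((s - σ) * phiMinus Ω a - N)) +
      ENNReal.ofReal (D ^ ((s - σ) * phiMinus Ω a) / c) *
        ENNReal.ofReal (Phi a x y (|u x - u y| / ‖x - y‖ ^ s) / ‖x - y‖ ^ N) := by
  have hp : 0 < phiMinus Ω a := by linarith [hg.1]
  rcases eq_or_ne x y with rfl | hxy
  · rw [gagKernel_self hp]; exact zero_le
  set p := phiMinus Ω a
  set d := ‖x - y‖ with hd
  have hd0 : 0 < d := norm_pos_iff.2 (sub_ne_zero.2 hxy)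
  set t := |u x - u y| / d ^ s with ht
  have ht0 : 0 ≤ t := by positivity
  have hD0 : 0 < D := hd0.trans_le hD
  have hPhi : 0 ≤ Phi a x y t := ha.Phi_nonneg hx hy ht0
  have key : |u x - u y| ^ p / d ^ (N + σ * p) ≤
      d ^ ((s - σ) * p - N) + D ^ ((s - σ) * p) / c * (Phi a x y t / d ^ N) := by
    have h1 : |u x - u y| = t * d ^ s := by rw [ht]; field_simp
    have h2 : |u x - u y| ^ p / d ^ (N + σ * p) = t ^ p * d ^ ((s - σ) * p - N) := by
      rw [h1, Real.mul_rpow ht0 (by positivity), ← Real.rpow_mul hd0.le, mul_div_assoc,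
        ← Real.rpow_sub hd0]
      congr 2; ring
    rw [h2]
    calc t ^ p * d ^ ((s - σ) * p - N) ≤ (1 + Phi a x y t / c) * d ^ ((s - σ) * p - N) := by
          gcongr
          exact ha.rpow_le hg hc hx hy (hcx x hx y hy) ht0
      _ = d ^ ((s - σ) * p - N) + d ^ ((s - σ) * p) / c * (Phi a x y t / d ^ N) := by
          rw [Real.rpow_sub hd0, Real.rpow_natCast]; field_simp
      _ ≤ _ := by
          gcongr
  calc gagKernel p σ u x y = ENNReal.ofReal (|u x - u y| ^ p / d ^ (N + σ * p)) := by
        rw [gagKernel, ENNReal.ofReal_div_of_pos (by positivity),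
          ← ENNReal.ofReal_rpow_of_nonneg (abs_nonneg _) hp.le,
          ← ENNReal.ofReal_rpow_of_pos hd0, hd, ofReal_norm,
          Real.enorm_eq_ofReal_abs]
    _ ≤ _ := ENNReal.ofReal_le_ofReal key
    _ = _ := by
        rw [ENNReal.ofReal_add (by positivity) (by positivity),
          ENNReal.ofReal_mul (by positivity)]

theorem lintegral_norm_rpow_ball_lt_top (hN : 1 ≤ N) {β : ℝ} (hβ : 0 < β) (D : ℝ) :
    ∫⁻ z in Metric.ball (0 : E N) D, ENNReal.ofReal (‖z‖ ^ (β - N)) < ∞ := by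
  have hm : Measurable fun z : E N => ‖z‖ ^ (β - N) := measurable_norm.pow_const _
  have h : IntegrableOn (fun z : E N => ‖z‖ ^ (β - N)) (Metric.ball 0 D) volume := by
    refine integrableOn_ball_of_norm_le_rpow (C := 1) (α := N - β) (by simpa using hN)
      (by simpa using hβ) (Eventually.of_forall fun z => ?_) hm.aestronglyMeasurable
    rw [Real.norm_of_nonneg (by positivity), one_mul, neg_sub]
  exact (hasFiniteIntegral_iff_ofReal (Eventually.of_forall fun z => by positivity)).1 h.2

theorem exists_energy_bound (hN : 1 ≤ N) (hb : Bornology.IsBounded Ω)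
    {s σ c : ℝ} (hσs : σ < s) (hΩm : MeasurableSet Ω)
    (ha : IsMusielak Ω a) (hg : GrowthCondition Ω a) (hc : 0 < c)
    (hcx : ∀ x ∈ Ω, ∀ y ∈ Ω, c ≤ Phi a x y 1) :
    ∃ K : ℝ≥0, ∀ u : E N → ℝ, modular Ω a u ≤ 1 → gagliardoModular Ω a s u ≤ 1 →
      eLpNorm u 1 (volume.restrict Ω) ≤ K ∧ gagEnergy Ω (phiMinus Ω a) σ u ≤ K := by
  set p := phiMinus Ω a with hpdef
  have hp : 1 < p := hg.1
  have hβ : 0 < (s - σ) * p := mul_pos (by linarith) (by linarith)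
  obtain ⟨D, hD⟩ : ∃ D : ℝ, ∀ x ∈ Ω, ∀ y ∈ Ω, ‖x - y‖ < D := by
    obtain ⟨D, hD⟩ := Metric.isBounded_iff.1 hb
    exact ⟨D + 1, fun x hx y hy => by rw [← dist_eq_norm]; linarith [hD hx hy]⟩
  set J := ∫⁻ z in Metric.ball (0 : E N) D, ENNReal.ofReal (‖z‖ ^ ((s - σ) * p - N)) with hJ
  have hJt : J < ∞ := lintegral_norm_rpow_ball_lt_top hN hβ D
  have hΩt : volume Ω < ∞ := hb.measure_lt_top
  set K₁ : ℝ≥0∞ := volume Ω + ENNReal.ofReal (1 / c) with hK₁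
  set K₂ : ℝ≥0∞ := J * volume Ω + ENNReal.ofReal (D ^ ((s - σ) * p) / c) with hK₂
  have hK₁t : K₁ ≠ ∞ := by simp [hK₁, hΩt.ne]
  have hK₂t : K₂ ≠ ∞ := by simp [hK₂, ENNReal.mul_eq_top, hΩt.ne, hJt.ne]
  refine ⟨(K₁ + K₂).toNNReal, fun u hu1 hu2 => ?_⟩
  rw [ENNReal.coe_toNNReal (by simp [hK₁t, hK₂t])]
  constructor
  · refine le_trans ?_ (le_self_add : K₁ ≤ K₁ + K₂)
    rw [eLpNorm_one_eq_lintegral_enorm]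
    calc ∫⁻ x in Ω, ‖u x‖ₑ
        ≤ ∫⁻ x in Ω, 1 + ENNReal.ofReal (1 / c) * ENNReal.ofReal (Phi a x x |u x|) := by
          refine setLIntegral_mono' hΩm fun x hx => ?_
          have hΦ := ha.Phi_nonneg hx hx (abs_nonneg (u x))
          rw [Real.enorm_eq_ofReal_abs, ← ENNReal.ofReal_mul (by positivity), ← ENNReal.ofReal_one,
            ← ENNReal.ofReal_add zero_le_one (by positivity)]
          refine ENNReal.ofReal_le_ofReal ?_
          have h := ha.rpow_le hg hc hx hx (hcx x hx x hx) (abs_nonneg (u x))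
          rw [one_div, inv_mul_eq_div]
          rcases le_total |u x| 1 with h1 | h1
          · have : 0 ≤ Phi a x x |u x| / c := by positivity
            linarith
          · exact (Real.self_le_rpow_of_one_le h1 hp.le).trans h
      _ = volume Ω + ENNReal.ofReal (1 / c) * modular Ω a u := by
          rw [lintegral_add_left measurable_const, lintegral_const_mul' _ _ ENNReal.ofReal_ne_top,
            setLIntegral_one, modular]
      _ ≤ K₁ := by
          rw [hK₁]; gcongr; exact mul_le_of_le_one_right' hu1
  · refine le_trans ?_ (le_add_self : K₂ ≤ K₁ + K₂)
    set B := ENNReal.ofReal (D ^ ((s - σ) * p) / c) with hB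
    have hm : ∀ x : E N, Measurable fun y : E N =>
        ENNReal.ofReal (‖x - y‖ ^ ((s - σ) * p - N)) := fun x =>
      ((measurable_const.sub measurable_id).norm.pow_const _).ennreal_ofReal
    calc gagEnergy Ω p σ u
        ≤ ∫⁻ x in Ω, ∫⁻ y in Ω, (ENNReal.ofReal (‖x - y‖ ^ ((s - σ) * p - N)) +
            B * ENNReal.ofReal (Phi a x y (|u x - u y| / ‖x - y‖ ^ s) / ‖x - y‖ ^ N)) :=
          setLIntegral_mono' hΩm fun x hx => setLIntegral_mono' hΩm fun y hy =>
            gagKernel_le_of_modular hσs ha hg hc hcx u hx hy (hD x hx y hy).le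
      _ ≤ ∫⁻ x in Ω, (J + B * ∫⁻ y in Ω,
            ENNReal.ofReal (Phi a x y (|u x - u y| / ‖x - y‖ ^ s) / ‖x - y‖ ^ N)) := by
          refine setLIntegral_mono' hΩm fun x hx => ?_
          rw [lintegral_add_left (hm x), lintegral_const_mul' _ _ ENNReal.ofReal_ne_top]
          gcongr
          -- For x in Ω the set x - Ω lies in B(0, D), so translation invariance gives a bound
          -- independent of x.
          calc ∫⁻ y in Ω, ENNReal.ofReal (‖x - y‖ ^ ((s - σ) * p - N))
              ≤ ∫⁻ y, (Metric.ball (0 : E N) D).indicator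
                  (fun z => ENNReal.ofReal (‖z‖ ^ ((s - σ) * p - N))) (x - y) := by
                rw [← lintegral_indicator hΩm]
                refine lintegral_mono fun y => ?_
                by_cases hy : y ∈ Ω
                · have : x - y ∈ Metric.ball (0 : E N) D := by
                    simpa using hD x hx y hy
                  rw [indicator_of_mem hy, indicator_of_mem this]
                · rw [indicator_of_notMem hy]; exact zero_le
            _ = J := by
                rw [lintegral_sub_left_eq_self, lintegral_indicator Metric.isOpen_ball.measurableSet]
      _ = J * volume Ω + B * gagliardoModular Ω a s u := by
          rw [lintegral_add_left measurable_const, lintegral_const_mul' _ _ ENNReal.ofReal_ne_top,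
            setLIntegral_const, gagliardoModular]
      _ ≤ K₂ := by
          rw [hK₂]; gcongr; exact mul_le_of_le_one_right' hu2

/-! ### Luxemburg norms -/

theorem modular_div_le (hΩm : MeasurableSet Ω) (ha : IsMusielak Ω a) (u : E N → ℝ) {k : ℝ}
    (hk : 1 ≤ k) : modular Ω a (fun x => u x / k) ≤ ENNReal.ofReal k⁻¹ * modular Ω a u := by
  rw [modular, modular, ← lintegral_const_mul' _ _ ENNReal.ofReal_ne_top]
  refine setLIntegral_mono' hΩm fun x hx => ?_
  rw [← ENNReal.ofReal_mul (by positivity)]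
  refine ENNReal.ofReal_le_ofReal ?_
  rw [abs_div, abs_of_pos (by linarith : 0 < k), inv_mul_eq_div]
  exact ha.Phi_div_le hx hx (abs_nonneg _) hk

theorem gagliardoModular_div_le (hΩm : MeasurableSet Ω) (ha : IsMusielak Ω a) (s : ℝ)
    (u : E N → ℝ) {k : ℝ} (hk : 1 ≤ k) :
    gagliardoModular Ω a s (fun x => u x / k) ≤ ENNReal.ofReal k⁻¹ * gagliardoModular Ω a s u := by
  rw [gagliardoModular, gagliardoModular, ← lintegral_const_mul' _ _ ENNReal.ofReal_ne_top]
  refine setLIntegral_mono' hΩm fun x hx => ?_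
  rw [← lintegral_const_mul' _ _ ENNReal.ofReal_ne_top]
  refine setLIntegral_mono' hΩm fun y hy => ?_
  rw [← ENNReal.ofReal_mul (by positivity)]
  refine ENNReal.ofReal_le_ofReal ?_
  have h : |u x / k - u y / k| / ‖x - y‖ ^ s = |u x - u y| / ‖x - y‖ ^ s / k := by
    rw [← sub_div, abs_div, abs_of_pos (by linarith : 0 < k)]; ring
  rw [h, ← mul_div_assoc, inv_mul_eq_div]
  gcongr
  exact ha.Phi_div_le hx hy (by positivity) hk

/-- Dividing a function of finite modular by k = m + 1 brings its modular below 1. Nonemptiness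
matters because the real infimum of the empty set is 0. -/
theorem exists_pos_le_one_of_scaling {m : (E N → ℝ) → ℝ≥0∞}
    (hm : ∀ (u : E N → ℝ) (k : ℝ), 1 ≤ k → m (fun x => u x / k) ≤ ENNReal.ofReal k⁻¹ * m u)
    {u : E N → ℝ} (hu : ∃ l : ℝ, 0 < l ∧ m (fun x => l * u x) < ∞) :
    {l : ℝ | 0 < l ∧ m (fun x => u x / l) ≤ 1}.Nonempty := by
  obtain ⟨l, hl, hfin⟩ := hu
  set k : ℝ := (m fun x => l * u x).toReal + 1 with hk
  have hk1 : 1 ≤ k := by rw [hk]; linarith [ENNReal.toReal_nonneg (a := m fun x => l * u x)]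
  refine ⟨k / l, by positivity, ?_⟩
  have h : (fun x => u x / (k / l)) = fun x => (l * u x) / k := by
    ext x; field_simp
  rw [h]
  refine (hm _ k hk1).trans ?_
  rw [← ENNReal.ofReal_toReal hfin.ne, ← ENNReal.ofReal_mul (by positivity), ← ENNReal.ofReal_one]
  refine ENNReal.ofReal_le_ofReal ?_
  rw [inv_mul_le_iff₀ (by linarith)]
  linarith

/-- Taking r strictly above the infimum avoids showing that it is attained, and covers functions of
norm zero. -/
theorem le_one_of_sInf_lt {m : (E N → ℝ) → ℝ≥0∞}
    (hm : ∀ (u : E N → ℝ) (k : ℝ), 1 ≤ k → m (fun x => u x / k) ≤ ENNReal.ofReal k⁻¹ * m u)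
    {u : E N → ℝ} (hu : ∃ l : ℝ, 0 < l ∧ m (fun x => l * u x) < ∞) {r : ℝ}
    (hr : sInf {l : ℝ | 0 < l ∧ m (fun x => u x / l) ≤ 1} < r) : m (fun x => u x / r) ≤ 1 := by
  obtain ⟨l, ⟨hl, hle⟩, hlr⟩ := exists_lt_of_csInf_lt (exists_pos_le_one_of_scaling hm hu) hr
  have hk : 1 ≤ r / l := by rw [one_le_div hl]; exact hlr.le
  have h : (fun x => u x / r) = fun x => (u x / l) / (r / l) := by
    ext x; rw [div_div, mul_div_cancel₀ _ hl.ne']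
  rw [h]
  refine (hm _ _ hk).trans ?_
  refine mul_le_one' ?_ hle
  rw [ENNReal.ofReal_le_one]
  exact inv_le_one_of_one_le₀ hk

theorem luxNorm_nonneg (u : E N → ℝ) : 0 ≤ luxNorm Ω a u :=
  Real.sInf_nonneg fun _ hl => hl.1.le

theorem gagliardoSeminorm_nonneg (s : ℝ) (u : E N → ℝ) : 0 ≤ gagliardoSeminorm Ω a s u :=
  Real.sInf_nonneg fun _ hl => hl.1.le

theorem normW_nonneg (s : ℝ) (u : E N → ℝ) : 0 ≤ normW Ω a s u :=
  add_nonneg (luxNorm_nonneg u) (gagliardoSeminorm_nonneg s u)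

theorem MemW.modulars_le_one (hΩm : MeasurableSet Ω) (ha : IsMusielak Ω a) {s : ℝ} {u : E N → ℝ}
    (hu : MemW Ω a s u) {r : ℝ} (hr : normW Ω a s u < r) :
    modular Ω a (fun x => u x / r) ≤ 1 ∧ gagliardoModular Ω a s (fun x => u x / r) ≤ 1 := by
  have h1 := luxNorm_nonneg (Ω := Ω) (a := a) u
  have h2 := gagliardoSeminorm_nonneg (Ω := Ω) (a := a) s u
  rw [normW] at hr
  exact ⟨le_one_of_sInf_lt (fun v k hk => modular_div_le hΩm ha v hk) hu.2.1
      (by unfold luxNorm at *; linarith),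
    le_one_of_sInf_lt (fun v k hk => gagliardoModular_div_le hΩm ha s v hk) hu.2.2
      (by unfold gagliardoSeminorm at *; linarith)⟩

end FracMusielak

end

/-! ### Fractional Sobolev estimates from the measure density condition. -/

noncomputable section

namespace FracMusielak

variable {N : ℕ} {Ω : Set (E N)} {c : ℝ≥0} {p σ : ℝ}

/-- The measure density condition `|Ω ∩ B(x, r)| ≥ c r^N` for `x ∈ Ω` and `0 < r ≤ 1`. -/
def MeasureDensity (Ω : Set (E N)) (c : ℝ≥0) : Prop :=
  ∀ x ∈ Ω, ∀ r : ℝ≥0, 0 < r → r ≤ 1 → (c * r ^ N : ℝ≥0∞) ≤ volume (Ω ∩ Metric.ball x r)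

/-! ### Averages -/

theorem lintegral_le_lintegral_rpow {α : Type*} [MeasurableSpace α] {ν : Measure α}
    [IsProbabilityMeasure ν] {f : α → ℝ≥0∞} (hf : AEMeasurable f ν) {q : ℝ} (hq : 1 ≤ q) :
    ∫⁻ x, f x ∂ν ≤ (∫⁻ x, f x ^ q ∂ν) ^ (1 / q) := by
  have := eLpNorm'_le_eLpNorm'_of_exponent_le one_pos hq ν hf.aestronglyMeasurable
  simpa [eLpNorm'] using this

/-- The uniform probability measure on `Ω ∩ B(x, r)`. -/
def unifBall (Ω : Set (E N)) (x : E N) (r : ℝ≥0) : Measure (E N) :=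
  ProbabilityTheory.cond volume (Ω ∩ Metric.ball x r)

theorem isProbabilityMeasure_unifBall (hd : MeasureDensity Ω c) (hc : 0 < c) {x : E N} (hx : x ∈ Ω)
    {r : ℝ≥0} (hr : 0 < r) (hr1 : r ≤ 1) : IsProbabilityMeasure (unifBall Ω x r) := by
  refine ProbabilityTheory.cond_isProbabilityMeasure_of_finite ?_ ?_
  · have : (0 : ℝ≥0∞) < c * r ^ N := by
      have h : 0 < c * r ^ N := by positivity
      exact_mod_cast h
    exact (this.trans_le (hd x hx r hr hr1)).ne'
  · exact ((measure_mono inter_subset_right).trans_lt measure_ball_lt_top).ne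

theorem unifBall_absolutelyContinuous (x : E N) (r : ℝ≥0) :
    unifBall Ω x r ≪ volume.restrict (Ω ∩ Metric.ball x r) :=
  Measure.smul_absolutelyContinuous

theorem ae_unifBall (hΩm : MeasurableSet Ω) (x : E N) (r : ℝ≥0) :
    ∀ᵐ z ∂(unifBall Ω x r), z ∈ Ω ∩ Metric.ball x r :=
  (unifBall_absolutelyContinuous x r).ae_le
    (ae_restrict_mem (hΩm.inter Metric.isOpen_ball.measurableSet))

theorem lintegral_unifBall_le (hd : MeasureDensity Ω c) {x : E N} (hx : x ∈ Ω)
    {r : ℝ≥0} (hr : 0 < r) (hr1 : r ≤ 1) (f : E N → ℝ≥0∞) :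
    ∫⁻ z, f z ∂(unifBall Ω x r) ≤ (c * r ^ N : ℝ≥0∞)⁻¹ * ∫⁻ z in Ω, f z := by
  rw [unifBall, ProbabilityTheory.cond, lintegral_smul_measure, smul_eq_mul]
  gcongr
  · exact hd x hx r hr hr1
  · exact inter_subset_left

/-! ### Measurability and pointwise estimates -/

theorem measurable_gagKernel {u : E N → ℝ} (hu : Measurable u) :
    Measurable fun z : E N × E N => gagKernel p σ u z.1 z.2 :=
  (((hu.comp measurable_fst).sub (hu.comp measurable_snd)).enorm.pow_const _).div
    ((measurable_fst.sub measurable_snd).enorm.pow_const _)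

theorem measurable_gagDensity {u : E N → ℝ} (hu : Measurable u) :
    Measurable (gagDensity Ω p σ u) :=
  (measurable_gagKernel hu).lintegral_prod_right'

theorem enorm_sub_rpow_le (hp : 0 < p) (hσ : 0 < σ) (u : E N → ℝ) {x z : E N} {R : ℝ≥0}
    (h : dist x z ≤ R) :
    ‖u x - u z‖ₑ ^ p ≤ (R : ℝ≥0∞) ^ (N + σ * p) * gagKernel p σ u x z := by
  have he : 0 ≤ N + σ * p := by positivity
  rcases eq_or_ne x z with rfl | hxz
  · simp [hp]
  have h0 : ‖x - z‖ₑ ^ (N + σ * p) ≠ 0 := by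
    rw [ne_eq, ENNReal.rpow_eq_zero_iff_of_pos (by positivity)]
    simpa [sub_eq_zero] using hxz
  have ht : ‖x - z‖ₑ ^ (N + σ * p) ≠ ∞ := ENNReal.rpow_ne_top_of_nonneg he enorm_ne_top
  have hle : ‖x - z‖ₑ ≤ R := by
    rw [← ofReal_norm, ← dist_eq_norm, ← ENNReal.ofReal_coe_nnreal]
    exact ENNReal.ofReal_le_ofReal h
  calc ‖u x - u z‖ₑ ^ p = ‖x - z‖ₑ ^ (N + σ * p) * gagKernel p σ u x z := by
        rw [gagKernel, ENNReal.mul_div_cancel h0 ht]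
    _ ≤ _ := by gcongr

/-- The normalisation r^(-N) of a mean cancels the dimensional part of the kernel weight; with e =
σp a pure gain r^(σp) remains. -/
theorem density_rpow_cancel (hc : 0 < c) {r : ℝ≥0} (hr : 0 < r) (e : ℝ) :
    (c * r ^ N : ℝ≥0∞)⁻¹ * ((2 * r : ℝ≥0) : ℝ≥0∞) ^ (N + e) =
      ((2 ^ (N + e) / c * r ^ e : ℝ≥0) : ℝ≥0∞) := by
  rw [← ENNReal.coe_rpow_of_ne_zero (by positivity), ← ENNReal.coe_pow, ← ENNReal.coe_mul,
    ← ENNReal.coe_inv (by positivity), ← ENNReal.coe_mul, ENNReal.coe_inj, NNReal.mul_rpow,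
    NNReal.rpow_add hr.ne', NNReal.rpow_natCast]
  field_simp

/-- The mean deviation from `u x` over a ball is controlled by the Gagliardo density at `x`. -/
theorem lintegral_unifBall_sub_le (hΩm : MeasurableSet Ω) (hd : MeasureDensity Ω c) (hc : 0 < c)
    (hp : 1 ≤ p) (hσ : 0 < σ) {u : E N → ℝ} (hu : Measurable u) {y : E N} (hy : y ∈ Ω)
    {r : ℝ≥0} (hr : 0 < r) (hr1 : r ≤ 1) {x : E N} (hx : dist x y < r) :
    ∫⁻ z, ‖u x - u z‖ₑ ∂(unifBall Ω y r) ≤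
      ((2 ^ (N + σ * p) / c) ^ (1 / p) * r ^ σ : ℝ≥0) * gagDensity Ω p σ u x ^ (1 / p) := by
  have hp0 : 0 < p := by linarith
  have := isProbabilityMeasure_unifBall hd hc hy hr hr1
  have hm : Measurable fun z => ‖u x - u z‖ₑ := (measurable_const.sub hu).enorm
  calc ∫⁻ z, ‖u x - u z‖ₑ ∂(unifBall Ω y r)
      ≤ (∫⁻ z, ‖u x - u z‖ₑ ^ p ∂(unifBall Ω y r)) ^ (1 / p) :=
        lintegral_le_lintegral_rpow hm.aemeasurable hp
    _ ≤ (∫⁻ z, ((2 * r : ℝ≥0) : ℝ≥0∞) ^ (N + σ * p) * gagKernel p σ u x z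
          ∂(unifBall Ω y r)) ^ (1 / p) := by
        refine ENNReal.rpow_le_rpow (lintegral_mono_ae ?_) (by positivity)
        filter_upwards [ae_unifBall hΩm y r] with z hz
        refine enorm_sub_rpow_le hp0 hσ u ?_
        have h2 := Metric.mem_ball'.1 hz.2
        push_cast
        linarith [dist_triangle x y z]
    _ ≤ ((c * r ^ N : ℝ≥0∞)⁻¹ * (((2 * r : ℝ≥0) : ℝ≥0∞) ^ (N + σ * p) *
          gagDensity Ω p σ u x)) ^ (1 / p) := by
        refine ENNReal.rpow_le_rpow ?_ (by positivity)
        refine (lintegral_unifBall_le hd hy hr hr1 _).trans_eq ?_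
        rw [lintegral_const_mul' _ _ (ENNReal.rpow_ne_top_of_nonneg (by positivity)
          ENNReal.coe_ne_top), gagDensity]
    _ = _ := by
        rw [← mul_assoc, density_rpow_cancel hc hr, ENNReal.mul_rpow_of_nonneg _ _ (by positivity),
          ← ENNReal.coe_rpow_of_nonneg _ (by positivity), NNReal.mul_rpow, ← NNReal.rpow_mul,
          mul_assoc σ, mul_one_div_cancel hp0.ne', mul_one]

theorem density_inv_rpow (hc : 0 < c) {r : ℝ≥0} (hr : 0 < r) {q : ℝ} (hq : 0 < q) (A : ℝ≥0∞) :
    ((c * r ^ N : ℝ≥0∞)⁻¹ * A) ^ (1 / q) =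
      (c ^ (-(1 / q)) * r ^ (-(N / q)) : ℝ≥0) * A ^ (1 / q) := by
  have h : 0 < c * r ^ N := by positivity
  rw [ENNReal.mul_rpow_of_nonneg _ _ (by positivity), ← ENNReal.coe_pow, ← ENNReal.coe_mul,
    ← ENNReal.coe_inv h.ne', ← ENNReal.coe_rpow_of_nonneg _ (by positivity),
    NNReal.inv_rpow, ← NNReal.rpow_neg, NNReal.mul_rpow, ← NNReal.rpow_natCast, ← NNReal.rpow_mul]
  congr 4
  ring

theorem lintegral_unifBall_enorm_le (hd : MeasureDensity Ω c) (hc : 0 < c) {u : E N → ℝ}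
    (hu : Measurable u) {x : E N} (hx : x ∈ Ω) {r : ℝ≥0} (hr : 0 < r) (hr1 : r ≤ 1) {q : ℝ}
    (hq : 1 ≤ q) :
    ∫⁻ z, ‖u z‖ₑ ∂(unifBall Ω x r) ≤
      (c ^ (-(1 / q)) * r ^ (-(N / q)) : ℝ≥0) *
        eLpNorm u (ENNReal.ofReal q) (volume.restrict Ω) := by
  have hq0 : 0 < q := by linarith
  have := isProbabilityMeasure_unifBall hd hc hx hr hr1
  rw [eLpNorm_eq_lintegral_rpow_enorm_toReal (by simpa using hq0) ENNReal.ofReal_ne_top,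
    ENNReal.toReal_ofReal hq0.le, ← density_inv_rpow hc hr hq0]
  refine (lintegral_le_lintegral_rpow hu.enorm.aemeasurable hq).trans ?_
  exact ENNReal.rpow_le_rpow (lintegral_unifBall_le hd hx hr hr1 _) (by positivity)

theorem enorm_le_sub_add_avg (hd : MeasureDensity Ω c) (hc : 0 < c) {u : E N → ℝ}
    (hu : Measurable u) {y : E N} (hy : y ∈ Ω) {r : ℝ≥0} (hr : 0 < r) (hr1 : r ≤ 1) (x : E N) :
    ‖u x‖ₑ ≤ ∫⁻ z, ‖u x - u z‖ₑ ∂(unifBall Ω y r) + ∫⁻ z, ‖u z‖ₑ ∂(unifBall Ω y r) := by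
  have := isProbabilityMeasure_unifBall hd hc hy hr hr1
  rw [← lintegral_add_right _ hu.enorm]
  calc ‖u x‖ₑ = ∫⁻ _, ‖u x‖ₑ ∂(unifBall Ω y r) := by simp
    _ ≤ _ := lintegral_mono fun z => by
      simpa using enorm_add_le (u x - u z) (u z)

/-! ### Ehrling type inequalities -/

/-- The `L^q` norm is controlled by an arbitrarily small multiple of the Gagliardo energy and a
large multiple of the `L^1` norm. -/
def Ehrling (Ω : Set (E N)) (p σ : ℝ) (q : ℝ≥0∞) : Prop :=
  ∀ ε : ℝ≥0, 0 < ε → ∃ C : ℝ≥0, ∀ u : E N → ℝ, Measurable u → gagEnergy Ω p σ u ≤ 1 →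
    eLpNorm u q (volume.restrict Ω) ≤ ε + C * eLpNorm u 1 (volume.restrict Ω)

theorem exists_mul_rpow_le {D ε : ℝ≥0} (hε : 0 < ε) {α : ℝ} (hα : 0 < α) :
    ∃ η : ℝ≥0, 0 < η ∧ η ≤ 1 ∧ D * η ^ α ≤ ε := by
  refine ⟨min 1 ((ε / (D + 1)) ^ (1 / α)), by positivity, min_le_left _ _, ?_⟩
  calc D * min 1 ((ε / (D + 1)) ^ (1 / α)) ^ α
      ≤ D * ((ε / (D + 1)) ^ (1 / α)) ^ α := by gcongr; exact min_le_right _ _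
    _ = D / (D + 1) * ε := by
        rw [← NNReal.rpow_mul, one_div_mul_cancel hα.ne', NNReal.rpow_one]; ring
    _ ≤ 1 * ε := by
        gcongr
        exact div_le_one_of_le₀ le_self_add (zero_le)
    _ = ε := one_mul ε

theorem Ehrling.one : Ehrling Ω p σ 1 := fun ε _ =>
  ⟨1, fun u _ _ => by simp⟩

theorem Ehrling.of_le (hb : Bornology.IsBounded Ω) {q q' : ℝ≥0∞} (hqq : q ≤ q')
    (h : Ehrling Ω p σ q') : Ehrling Ω p σ q := by
  intro ε hε
  have hΩt : volume Ω < ∞ := hb.measure_lt_top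
  rcases eq_or_ne q 0 with rfl | hq0
  · exact ⟨0, fun u _ _ => by simp⟩
  have hexp : 0 ≤ 1 / q.toReal - 1 / q'.toReal := by
    rcases eq_or_ne q' ∞ with rfl | hq'
    · simp
    · have h1 : 0 < q.toReal := ENNReal.toReal_pos hq0 (ne_top_of_le_ne_top hq' hqq)
      have h2 : q.toReal ≤ q'.toReal := ENNReal.toReal_mono hq' hqq
      rw [sub_nonneg]
      exact one_div_le_one_div_of_le h1 h2
  set V : ℝ≥0 := ((volume Ω) ^ (1 / q.toReal - 1 / q'.toReal)).toNNReal with hV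
  have hVc : (V : ℝ≥0∞) = (volume Ω) ^ (1 / q.toReal - 1 / q'.toReal) :=
    ENNReal.coe_toNNReal (ENNReal.rpow_ne_top_of_nonneg hexp hΩt.ne)
  obtain ⟨C, hC⟩ := h (ε / (V + 1)) (by positivity)
  refine ⟨C * V, fun u hu hE => ?_⟩
  have h1 := eLpNorm_le_eLpNorm_mul_rpow_measure_univ (μ := volume.restrict Ω) hqq
    hu.aestronglyMeasurable
  rw [Measure.restrict_apply_univ, ← hVc] at h1
  have h2 : ε / (V + 1) * V ≤ ε := by
    rw [div_mul_eq_mul_div, div_le_iff₀ (by positivity)]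
    gcongr; exact le_self_add
  calc _ ≤ _ := h1
    _ ≤ ((ε / (V + 1) : ℝ≥0) + C * eLpNorm u 1 (volume.restrict Ω)) * V := by
        gcongr; exact hC u hu hE
    _ = ((ε / (V + 1) * V : ℝ≥0) : ℝ≥0∞) + (C * V : ℝ≥0) * eLpNorm u 1 (volume.restrict Ω) := by
        push_cast; ring
    _ ≤ _ := by gcongr

/-- A bootstrapping step improves the exponent `q` to `p + (σ p / N) q`. -/
theorem Ehrling.bootstrap (hN : 1 ≤ N) (hΩm : MeasurableSet Ω) (hb : Bornology.IsBounded Ω)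
    (hd : MeasureDensity Ω c) (hc : 0 < c) (hp : 1 ≤ p) (hσ : 0 < σ) {q : ℝ} (hq : 1 ≤ q)
    (h : Ehrling Ω p σ (ENNReal.ofReal q)) :
    Ehrling Ω p σ (ENNReal.ofReal (p + σ * p / N * q)) := by
  have hp0 : 0 < p := by linarith
  have hq0 : 0 < q := by linarith
  have hN0 : (0 : ℝ) < N := by exact_mod_cast hN
  have hΩt : volume Ω < ∞ := hb.measure_lt_top
  set q' : ℝ := p + σ * p / N * q with hq'
  have hq'0 : 0 < q' := by positivity
  -- With radius r = η g^(-κ), the deviation r^σ g^(1/p) and the mean r^(-N/q) carry the same power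
  -- of g exactly for this κ; that power is 1/q'.
  set κ : ℝ := 1 / (p * (σ + N / q)) with hκ
  have hκ0 : 0 < κ := by positivity
  have hκ1 : κ * (N / q) = 1 / q' := by
    rw [hκ, hq']; field_simp
    ring
  have hκ2 : 1 / p - κ * σ = 1 / q' := by
    rw [← hκ1, hκ]; field_simp; ring
  set V : ℝ≥0 := (volume Ω).toNNReal with hV
  have hVc : (V : ℝ≥0∞) = volume Ω := ENNReal.coe_toNNReal hΩt.ne
  set C₁ : ℝ≥0 := (2 ^ (N + σ * p) / c) ^ (1 / p) with hC₁
  have hC₁0 : 0 < C₁ := by positivity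
  set C₂ : ℝ≥0 := c ^ (-(1 / q)) with hC₂
  set D : ℝ≥0 := (V + 1) ^ (1 / q') with hD
  intro ε hε
  -- η is fixed first to make the deviation small; the inequality for q is then invoked with a
  -- parameter small enough to absorb η^(-N/q).
  obtain ⟨η, hη0, hη1, hηε⟩ := exists_mul_rpow_le (D := D * C₁) (half_pos hε) hσ
  obtain ⟨C, hC⟩ := h (ε / 2 / (D * C₂ * η ^ (-(N / q)) + 1)) (by positivity)
  refine ⟨D * C₂ * η ^ (-(N / q)) * C, fun u hu hE => ?_⟩
  set m := eLpNorm u (ENNReal.ofReal q) (volume.restrict Ω) with hm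
  set A : ℝ≥0∞ := (C₁ * η ^ σ : ℝ≥0) + (C₂ * η ^ (-(N / q)) : ℝ≥0) * m with hA
  have hA0 : A ≠ 0 := by
    have : 0 < C₁ * η ^ σ := by positivity
    rw [hA, ne_eq, add_eq_zero, not_and_or]
    left; exact_mod_cast this.ne'
  have hpt : ∀ x ∈ Ω, ‖u x‖ₑ ≤ A * (1 + gagDensity Ω p σ u x) ^ (1 / q') := by
    intro x hx
    set G := gagDensity Ω p σ u x with hG
    rcases eq_or_ne G ∞ with hGt | hGt
    · rw [hGt, add_top, ENNReal.top_rpow_of_pos (by positivity), ENNReal.mul_top hA0]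
      exact le_top
    -- Adding 1 keeps the radius at most 1, as the density condition requires, and costs only |Ω|
    -- after integration.
    set g : ℝ≥0 := 1 + G.toNNReal with hg
    have hgc : (1 : ℝ≥0∞) + G = g := by
      rw [hg]; push_cast; rw [ENNReal.coe_toNNReal hGt]
    have hg1 : 1 ≤ g := le_self_add
    have hg0 : 0 < g := by positivity
    set r : ℝ≥0 := η * g ^ (-κ) with hr
    have hr0 : 0 < r := by positivity
    have hr1 : r ≤ 1 := mul_le_one' hη1 (NNReal.rpow_le_one_of_one_le_of_nonpos hg1 (by linarith))
    have hGg : G ≤ g := hgc ▸ le_add_self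
    calc ‖u x‖ₑ ≤ _ := enorm_le_sub_add_avg hd hc hu hx hr0 hr1 x
      _ ≤ (C₁ * r ^ σ : ℝ≥0) * G ^ (1 / p) + (C₂ * r ^ (-(N / q)) : ℝ≥0) * m :=
          add_le_add (lintegral_unifBall_sub_le hΩm hd hc hp hσ hu hx hr0 hr1 (by simpa using hr0))
            (lintegral_unifBall_enorm_le hd hc hu hx hr0 hr1 hq)
      _ ≤ (C₁ * r ^ σ : ℝ≥0) * (g ^ (1 / p) : ℝ≥0) + (C₂ * r ^ (-(N / q)) : ℝ≥0) * m := by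
          rw [ENNReal.coe_rpow_of_nonneg _ (by positivity)]
          gcongr
      _ = A * (g ^ (1 / q') : ℝ≥0) := by
          have e1 : r ^ σ * g ^ (1 / p) = η ^ σ * g ^ (1 / q') := by
            rw [hr, NNReal.mul_rpow, ← NNReal.rpow_mul, mul_assoc, ← NNReal.rpow_add hg0.ne', ← hκ2]
            congr 2; ring
          have e2 : r ^ (-(N / q)) = η ^ (-(N / q)) * g ^ (1 / q') := by
            rw [hr, NNReal.mul_rpow, ← NNReal.rpow_mul, ← hκ1]
            congr 2; ring
          rw [← ENNReal.coe_mul, mul_assoc, e1, e2, hA]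
          push_cast; ring
      _ = A * (1 + G) ^ (1 / q') := by
          rw [hgc, ENNReal.coe_rpow_of_nonneg _ (by positivity)]
  have hGm : Measurable (gagDensity Ω p σ u) := measurable_gagDensity hu
  have hnorm : eLpNorm u (ENNReal.ofReal q') (volume.restrict Ω) ≤ A * D := by
    rw [eLpNorm_eq_lintegral_rpow_enorm_toReal (by simpa using hq'0) ENNReal.ofReal_ne_top,
      ENNReal.toReal_ofReal hq'0.le]
    calc (∫⁻ x in Ω, ‖u x‖ₑ ^ q') ^ (1 / q')
        ≤ (∫⁻ x in Ω, A ^ q' * (1 + gagDensity Ω p σ u x)) ^ (1 / q') := by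
          refine ENNReal.rpow_le_rpow (setLIntegral_mono' hΩm fun x hx => ?_) (by positivity)
          refine (ENNReal.rpow_le_rpow (hpt x hx) hq'0.le).trans_eq ?_
          rw [ENNReal.mul_rpow_of_nonneg _ _ hq'0.le, ← ENNReal.rpow_mul,
            one_div_mul_cancel hq'0.ne', ENNReal.rpow_one]
      _ = A * (volume Ω + gagEnergy Ω p σ u) ^ (1 / q') := by
          rw [lintegral_const_mul _ (show Measurable fun x => 1 + gagDensity Ω p σ u x from
            measurable_const.add hGm), lintegral_add_left measurable_const,
            setLIntegral_one, ENNReal.mul_rpow_of_nonneg _ _ (by positivity), ← ENNReal.rpow_mul,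
            mul_one_div_cancel hq'0.ne', ENNReal.rpow_one, gagEnergy]
      _ ≤ A * D := by
          rw [hD, ENNReal.coe_rpow_of_nonneg _ (by positivity)]
          push_cast
          rw [hVc]
          gcongr
  refine hnorm.trans ?_
  set B : ℝ≥0 := D * C₂ * η ^ (-(N / q)) with hB
  have hBε : B * (ε / 2 / (B + 1)) ≤ ε / 2 := by
    rw [mul_div_assoc', div_le_iff₀ (by positivity), mul_comm]
    gcongr; exact le_self_add
  calc A * D = (D * C₁ * η ^ σ : ℝ≥0) + (B : ℝ≥0) * m := by
        rw [hA, hB]; push_cast; ring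
    _ ≤ (ε / 2 : ℝ≥0) + (B : ℝ≥0) * ((ε / 2 / (B + 1) : ℝ≥0) +
          C * eLpNorm u 1 (volume.restrict Ω)) := by
        gcongr
        exact hC u hu hE
    _ = ((ε / 2 : ℝ≥0) + (B * (ε / 2 / (B + 1)) : ℝ≥0)) +
          (B * C : ℝ≥0) * eLpNorm u 1 (volume.restrict Ω) := by
        push_cast; ring
    _ ≤ ((ε / 2 : ℝ≥0) + (ε / 2 : ℝ≥0)) + (B * C : ℝ≥0) * eLpNorm u 1 (volume.restrict Ω) := by
        gcongr
    _ = _ := by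
        rw [← ENNReal.coe_add, add_halves]

/-- The Ehrling inequality holds for all exponents below the critical one. -/
theorem ehrling_of_lt_critical (hN : 1 ≤ N) (hΩm : MeasurableSet Ω) (hb : Bornology.IsBounded Ω)
    (hd : MeasureDensity Ω c) (hc : 0 < c) (hp : 1 ≤ p) (hσ : 0 < σ) (hσp : σ * p < N) {q : ℝ}
    (hq : q < N * p / (N - σ * p)) : Ehrling Ω p σ (ENNReal.ofReal q) := by
  have hN0 : (0 : ℝ) < N := by exact_mod_cast hN
  have hp0 : 0 < p := by linarith
  set b : ℝ := σ * p / N with hbdef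
  have hb0 : 0 < b := by positivity
  have hb1 : b < 1 := by rw [hbdef, div_lt_one hN0]; exact hσp
  set P : ℝ := N * p / (N - σ * p) with hP
  have hPfix : p + b * P = P := by
    have : (N : ℝ) - σ * p ≠ 0 := by linarith
    have h : P * (N - σ * p) = N * p := div_mul_cancel₀ _ this
    rw [hbdef]; field_simp; linarith
  have hP1 : 1 ≤ P := by
    rw [hP, le_div_iff₀ (by linarith)]
    nlinarith [mul_pos hσ hp0]
  -- These are the iterates of q ↦ p + bq started at q = 1; P is its fixed point, and b < 1 gives
  -- convergence to P.
  have hiter : ∀ k : ℕ, Ehrling Ω p σ (ENNReal.ofReal (P - b ^ k * (P - 1))) := by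
    intro k
    induction k with
    | zero => simpa using Ehrling.one
    | succ k ih =>
      have hbk : b ^ k ≤ 1 := pow_le_one₀ hb0.le hb1.le
      have h1 : 1 ≤ P - b ^ k * (P - 1) := by nlinarith
      have := ih.bootstrap hN hΩm hb hd hc hp hσ h1
      convert this using 2
      rw [← hbdef]
      linear_combination -hPfix
  have hlim : Tendsto (fun k : ℕ => P - b ^ k * (P - 1)) atTop (𝓝 (P - 0 * (P - 1))) :=
    ((tendsto_pow_atTop_nhds_zero_of_lt_one hb0.le hb1).mul_const _).const_sub _
  rw [zero_mul, sub_zero] at hlim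
  obtain ⟨k, hk⟩ := (hlim.eventually (lt_mem_nhds hq)).exists
  exact (hiter k).of_le hb (ENNReal.ofReal_le_ofReal hk.le)


/-! ### Dyadic means and Morrey's case. -/

/-- The averages of `|u|` over concentric balls of radii `r / 2` and `r` differ by at most a
constant times `r^(σ - N/p)` if the Gagliardo energy of `u` is at most `1`. -/
theorem avg_half_le (hΩm : MeasurableSet Ω) (hd : MeasureDensity Ω c) (hc : 0 < c)
    (hp : 1 ≤ p) (hσ : 0 < σ) {u : E N → ℝ} (hu : Measurable u) (hE : gagEnergy Ω p σ u ≤ 1)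
    {x : E N} (hx : x ∈ Ω) {r : ℝ≥0} (hr : 0 < r) (hr1 : r ≤ 1) :
    ∫⁻ z, ‖u z‖ₑ ∂(unifBall Ω x (r / 2)) ≤ ∫⁻ z, ‖u z‖ₑ ∂(unifBall Ω x r) +
      ((2 ^ (N + σ * p) / c) ^ (1 / p) * (c ^ (-(1 / p)) * 2 ^ (N / p)) * r ^ (σ - N / p) :
        ℝ≥0) := by
  have hp0 : 0 < p := by linarith
  have hr2 : 0 < r / 2 := half_pos hr
  have hr21 : r / 2 ≤ 1 := (half_le_self (zero_le)).trans hr1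
  have hrr : r / 2 ≤ r := half_le_self (zero_le)
  have := isProbabilityMeasure_unifBall hd hc hx hr2 hr21
  set C₁ : ℝ≥0 := (2 ^ (N + σ * p) / c) ^ (1 / p) with hC₁
  set G := gagDensity Ω p σ u with hG
  have hGm : Measurable G := measurable_gagDensity hu
  -- Jensen moves the power outside the mean; energy at most 1 and the density condition bound what
  -- is left.
  have havgG : ∫⁻ w, G w ^ (1 / p) ∂(unifBall Ω x (r / 2)) ≤
      (c ^ (-(1 / p)) * (r / 2) ^ (-(N / p)) : ℝ≥0) := by
    calc ∫⁻ w, G w ^ (1 / p) ∂(unifBall Ω x (r / 2))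
        ≤ (∫⁻ w, (G w ^ (1 / p)) ^ p ∂(unifBall Ω x (r / 2))) ^ (1 / p) :=
          lintegral_le_lintegral_rpow (hGm.pow_const _).aemeasurable hp
      _ = (∫⁻ w, G w ∂(unifBall Ω x (r / 2))) ^ (1 / p) := by
          simp_rw [← ENNReal.rpow_mul, one_div_mul_cancel hp0.ne', ENNReal.rpow_one]
      _ ≤ ((c * ((r / 2 : ℝ≥0) : ℝ≥0∞) ^ N : ℝ≥0∞)⁻¹ * 1) ^ (1 / p) := by
          refine ENNReal.rpow_le_rpow ?_ (by positivity)
          refine (lintegral_unifBall_le hd hx hr2 hr21 _).trans ?_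
          gcongr
          exact hE
      _ = _ := by rw [density_inv_rpow hc hr2 hp0, ENNReal.one_rpow, mul_one]
  calc ∫⁻ w, ‖u w‖ₑ ∂(unifBall Ω x (r / 2))
      ≤ ∫⁻ w, (((C₁ * r ^ σ : ℝ≥0) * G w ^ (1 / p)) + ∫⁻ z, ‖u z‖ₑ ∂(unifBall Ω x r))
          ∂(unifBall Ω x (r / 2)) := by
        refine lintegral_mono_ae ?_
        filter_upwards [ae_unifBall hΩm x (r / 2)] with w hw
        refine (enorm_le_sub_add_avg hd hc hu hx hr hr1 w).trans ?_
        gcongr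
        exact lintegral_unifBall_sub_le hΩm hd hc hp hσ hu hx hr hr1
          ((Metric.mem_ball.1 hw.2).trans_le hrr)
    _ = (C₁ * r ^ σ : ℝ≥0) * ∫⁻ w, G w ^ (1 / p) ∂(unifBall Ω x (r / 2)) +
          ∫⁻ z, ‖u z‖ₑ ∂(unifBall Ω x r) := by
        rw [lintegral_add_right _ measurable_const, lintegral_const_mul' _ _ ENNReal.coe_ne_top,
          lintegral_const, measure_univ, mul_one]
    _ ≤ (C₁ * r ^ σ : ℝ≥0) * (c ^ (-(1 / p)) * (r / 2) ^ (-(N / p)) : ℝ≥0) +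
          ∫⁻ z, ‖u z‖ₑ ∂(unifBall Ω x r) := by gcongr
    _ = _ := by
        rw [add_comm, ← ENNReal.coe_mul]
        congr 2
        rw [NNReal.div_rpow, NNReal.rpow_neg 2, div_inv_eq_mul, sub_eq_add_neg,
          NNReal.rpow_add hr.ne']
        ring

/-- Morrey's case: for `σ p > N` the `L^∞` norm satisfies the Ehrling inequality. -/
theorem ehrling_top (hΩm : MeasurableSet Ω) (hd : MeasureDensity Ω c) (hc : 0 < c)
    (hp : 1 ≤ p) (hσ : 0 < σ) (hσp : N < σ * p) : Ehrling Ω p σ ∞ := by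
  have hp0 : 0 < p := by linarith
  set α : ℝ := σ - N / p with hα
  have hα0 : 0 < α := by rw [hα, sub_pos, div_lt_iff₀ hp0]; exact hσp
  set C₁ : ℝ≥0 := (2 ^ (N + σ * p) / c) ^ (1 / p) with hC₁
  set C₂ : ℝ≥0 := C₁ * (c ^ (-(1 / p)) * 2 ^ (N / p)) with hC₂
  set θ : ℝ≥0 := (1 / 2) ^ α with hθ
  have hθ1 : θ < 1 := NNReal.rpow_lt_one (by norm_num) hα0
  intro ε hε
  -- The errors at radii ρ 2^(-k) form a geometric series of sum C₂ρ^α/(1 - θ); ρ makes it at most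
  -- ε.
  obtain ⟨ρ, hρ0, hρ1, hρε⟩ := exists_mul_rpow_le (D := C₂ * (1 - θ)⁻¹) hε hα0
  refine ⟨c ^ (-(1 / (1 : ℝ))) * ρ ^ (-(N / (1 : ℝ))), fun u hu hE => ?_⟩
  set r : ℕ → ℝ≥0 := fun k => ρ * (1 / 2) ^ k with hr
  have hr0 : ∀ k, 0 < r k := fun k => by simp only [hr]; positivity
  have hr1 : ∀ k, r k ≤ 1 := fun k =>
    mul_le_one' hρ1 (pow_le_one₀ (zero_le) (by norm_num))
  have hrs : ∀ k, r (k + 1) = r k / 2 := fun k => by simp only [hr, pow_succ]; ring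
  have hrα : ∀ k, r k ^ α = ρ ^ α * θ ^ k := fun k => by
    simp only [hr, hθ]
    rw [NNReal.mul_rpow, ← NNReal.rpow_natCast, ← NNReal.rpow_mul, mul_comm (k : ℝ),
      NNReal.rpow_mul, NNReal.rpow_natCast]
  have hGt : ∀ᵐ x ∂(volume.restrict Ω), gagDensity Ω p σ u x < ∞ :=
    ae_lt_top (measurable_gagDensity hu) (hE.trans_lt ENNReal.one_lt_top).ne
  rw [eLpNorm_exponent_top]
  refine eLpNormEssSup_le_of_ae_enorm_bound ?_
  filter_upwards [hGt, ae_restrict_mem hΩm] with x hxG hx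
  set m : ℕ → ℝ≥0∞ := fun k => ∫⁻ z, ‖u z‖ₑ ∂(unifBall Ω x (r k)) with hm
  have hmk : ∀ k, m k ≤ m 0 + (C₂ * ρ ^ α * ∑ i ∈ Finset.range k, θ ^ i : ℝ≥0) := by
    intro k
    induction k with
    | zero => simp
    | succ k ih =>
      have h := avg_half_le hΩm hd hc hp hσ hu hE hx (hr0 k) (hr1 k)
      rw [← hrs, hrα] at h
      calc m (k + 1) ≤ _ := h
        _ ≤ (m 0 + (C₂ * ρ ^ α * ∑ i ∈ Finset.range k, θ ^ i : ℝ≥0)) +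
            (C₂ * (ρ ^ α * θ ^ k) : ℝ≥0) := by gcongr
        _ = _ := by
            rw [add_assoc, ← ENNReal.coe_add, Finset.sum_range_succ]
            congr 2; ring
  have hsum : ∀ k, ∑ i ∈ Finset.range k, θ ^ i ≤ (1 - θ)⁻¹ := fun k => by
    rw [← NNReal.tsum_geometric hθ1]
    exact (NNReal.summable_geometric hθ1).sum_le_tsum _ (fun _ _ => zero_le)
  have hbound : ∀ k, ‖u x‖ₑ ≤ (C₁ * r k ^ σ : ℝ≥0) * gagDensity Ω p σ u x ^ (1 / p) +
      (m 0 + ε) := by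
    intro k
    calc ‖u x‖ₑ ≤ _ := enorm_le_sub_add_avg hd hc hu hx (hr0 k) (hr1 k) x
      _ ≤ (C₁ * r k ^ σ : ℝ≥0) * gagDensity Ω p σ u x ^ (1 / p) + m k := by
          gcongr
          exact lintegral_unifBall_sub_le hΩm hd hc hp hσ hu hx (hr0 k) (hr1 k)
            (by simpa using hr0 k)
      _ ≤ _ := by
          gcongr
          refine (hmk k).trans ?_
          gcongr
          calc C₂ * ρ ^ α * ∑ i ∈ Finset.range k, θ ^ i ≤ C₂ * ρ ^ α * (1 - θ)⁻¹ := by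
                gcongr; exact hsum k
            _ = C₂ * (1 - θ)⁻¹ * ρ ^ α := by ring
            _ ≤ ε := hρε
  -- The deviation of u(x) from its means vanishes as k → ∞ because the Gagliardo density at x is
  -- finite; no Lebesgue differentiation is involved.
  have hlim : Tendsto (fun k => ((C₁ * r k ^ σ : ℝ≥0) : ℝ≥0∞) * gagDensity Ω p σ u x ^ (1 / p) +
      (m 0 + ε)) atTop (𝓝 (((C₁ * (ρ * 0) ^ σ : ℝ≥0) : ℝ≥0∞) * gagDensity Ω p σ u x ^ (1 / p) +
      (m 0 + ε))) := by
    refine Tendsto.add ?_ tendsto_const_nhds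
    refine ENNReal.Tendsto.mul_const ?_
      (Or.inr (ENNReal.rpow_ne_top_of_nonneg (by positivity) hxG.ne))
    refine ENNReal.tendsto_coe.2 (Tendsto.const_mul _ ?_)
    refine Tendsto.nnrpow ?_ tendsto_const_nhds (Or.inr hσ)
    exact (tendsto_pow_atTop_nhds_zero_of_lt_one (zero_le) (by norm_num)).const_mul _
  have h := ge_of_tendsto' hlim hbound
  rw [mul_zero, NNReal.zero_rpow hσ.ne', mul_zero, ENNReal.coe_zero, zero_mul, zero_add] at h
  refine h.trans ?_
  rw [add_comm]
  gcongr
  have h0 : r 0 = ρ := by simp [hr]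
  have := lintegral_unifBall_enorm_le hd hc hu hx (hr0 0) (hr1 0) le_rfl
  rw [ENNReal.ofReal_one, h0] at this
  simpa only [hm, h0] using this


/-! ### Finitely many means and precompactness. -/

theorem exists_finite_net (hb : Bornology.IsBounded Ω) {ρ : ℝ} (hρ : 0 < ρ) :
    ∃ t : Finset (E N), (∀ y ∈ t, y ∈ Ω) ∧ ∀ x ∈ Ω, ∃ y ∈ t, dist x y < ρ := by
  obtain ⟨t, ht, hf, hc⟩ := Metric.finite_approx_of_totallyBounded
    (hb.isCompact_closure.totallyBounded.subset subset_closure) ρ hρ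
  refine ⟨hf.toFinset, fun y hy => ht (hf.mem_toFinset.1 hy), fun x hx => ?_⟩
  obtain ⟨y, hy, hxy⟩ := mem_iUnion₂.1 (hc hx)
  exact ⟨y, hf.mem_toFinset.2 hy, hxy⟩

theorem integrable_unifBall {u : E N → ℝ} (hu : IntegrableOn u Ω) {y : E N} {r : ℝ≥0}
    (h0 : volume (Ω ∩ Metric.ball y r) ≠ 0) : Integrable u (unifBall Ω y r) :=
  Integrable.smul_measure (hu.mono_set inter_subset_left) (ENNReal.inv_ne_top.2 h0)

theorem MeasureDensity.measure_ne_zero (hd : MeasureDensity Ω c) (hc : 0 < c) {x : E N}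
    (hx : x ∈ Ω) {r : ℝ≥0} (hr : 0 < r) (hr1 : r ≤ 1) : volume (Ω ∩ Metric.ball x r) ≠ 0 := by
  have h : 0 < c * r ^ N := by positivity
  have h' : (0 : ℝ≥0∞) < c * r ^ N := by exact_mod_cast h
  exact (h'.trans_le (hd x hx r hr hr1)).ne'

/-- Up to a term of order `ρ^σ`, the `L^1` norm is controlled by finitely many averages over balls
of radius `ρ`. -/
theorem eLpNorm_one_le_sum_avg (hΩm : MeasurableSet Ω) (hd : MeasureDensity Ω c) (hc : 0 < c)
    (hp : 1 ≤ p) (hσ : 0 < σ) {ρ : ℝ≥0} (hρ : 0 < ρ) (hρ1 : ρ ≤ 1) {t : Finset (E N)}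
    (ht : ∀ y ∈ t, y ∈ Ω) (hcov : ∀ x ∈ Ω, ∃ y ∈ t, dist x y < ρ) {u : E N → ℝ}
    (hu : Measurable u) (hui : IntegrableOn u Ω) (hE : gagEnergy Ω p σ u ≤ 1) :
    eLpNorm u 1 (volume.restrict Ω) ≤
      ((2 ^ (N + σ * p) / c) ^ (1 / p) * ρ ^ σ : ℝ≥0) * (volume Ω + 1) +
        volume Ω * ∑ y ∈ t, ‖∫ z, u z ∂(unifBall Ω y ρ)‖ₑ := by
  have hp0 : 0 < p := by linarith
  set C₁ : ℝ≥0 := (2 ^ (N + σ * p) / c) ^ (1 / p) * ρ ^ σ with hC₁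
  -- Summing over all centres makes the bound independent of which nearby centre is used for x.
  set S := ∑ y ∈ t, ‖∫ z, u z ∂(unifBall Ω y ρ)‖ₑ with hS
  have hpt : ∀ x ∈ Ω, ‖u x‖ₑ ≤ (C₁ : ℝ≥0∞) * (1 + gagDensity Ω p σ u x) + S := by
    intro x hx
    obtain ⟨y, hyt, hxy⟩ := hcov x hx
    have hy := ht y hyt
    have := isProbabilityMeasure_unifBall hd hc hy hρ hρ1
    have hint := integrable_unifBall hui (hd.measure_ne_zero hc hy hρ hρ1)
    have h1 : u x = ∫ z, (u x - u z) ∂(unifBall Ω y ρ) + ∫ z, u z ∂(unifBall Ω y ρ) := by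
      rw [integral_sub (integrable_const _) hint]; simp
    set G := gagDensity Ω p σ u x
    have hG : G ^ (1 / p) ≤ 1 + G := by
      rcases le_total G 1 with h | h
      · exact (ENNReal.rpow_le_one h (by positivity)).trans le_self_add
      · calc G ^ (1 / p) ≤ G ^ (1 : ℝ) :=
              ENNReal.rpow_le_rpow_of_exponent_le h (by rw [div_le_one hp0]; exact hp)
          _ = G := ENNReal.rpow_one G
          _ ≤ 1 + G := le_add_self
    calc ‖u x‖ₑ ≤ ‖∫ z, (u x - u z) ∂(unifBall Ω y ρ)‖ₑ + ‖∫ z, u z ∂(unifBall Ω y ρ)‖ₑ := by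
          conv_lhs => rw [h1]
          exact enorm_add_le _ _
      _ ≤ (C₁ : ℝ≥0∞) * (1 + G) + S := by
          refine add_le_add ?_ (Finset.single_le_sum
            (f := fun y => ‖∫ z, u z ∂(unifBall Ω y ρ)‖ₑ) (fun _ _ => zero_le) hyt)
          refine (enorm_integral_le_lintegral_enorm _).trans ?_
          refine (lintegral_unifBall_sub_le hΩm hd hc hp hσ hu hy hρ hρ1 hxy).trans ?_
          gcongr
  rw [eLpNorm_one_eq_lintegral_enorm]
  calc ∫⁻ x in Ω, ‖u x‖ₑ ≤ ∫⁻ x in Ω, ((C₁ : ℝ≥0∞) * (1 + gagDensity Ω p σ u x) + S) :=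
        setLIntegral_mono' hΩm hpt
    _ = (C₁ : ℝ≥0∞) * (volume Ω + gagEnergy Ω p σ u) + volume Ω * S := by
        rw [lintegral_add_right _ measurable_const, lintegral_const_mul' _ _ ENNReal.coe_ne_top,
          lintegral_add_left measurable_const, setLIntegral_one, setLIntegral_const, gagEnergy,
          mul_comm S]
    _ ≤ _ := by gcongr

/-- Total boundedness in quantitative form: up to ε the L^q norm is governed by finitely many linear
functionals. The means are signed so that they pass to differences. -/
theorem Ehrling.exists_sum_avg (hΩm : MeasurableSet Ω) (hb : Bornology.IsBounded Ω)
    (hd : MeasureDensity Ω c) (hc : 0 < c) (hp : 1 ≤ p) (hσ : 0 < σ) {q : ℝ≥0∞}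
    (h : Ehrling Ω p σ q) {t : ℕ → Finset (E N)} (ht : ∀ m, ∀ y ∈ t m, y ∈ Ω)
    (hcov : ∀ m, ∀ x ∈ Ω, ∃ y ∈ t m, dist x y < ((1 / (m + 1) : ℝ≥0) : ℝ)) {ε : ℝ≥0}
    (hε : 0 < ε) :
    ∃ (m : ℕ) (C : ℝ≥0), ∀ u : E N → ℝ, Measurable u → IntegrableOn u Ω →
      gagEnergy Ω p σ u ≤ 1 → eLpNorm u q (volume.restrict Ω) ≤
        ε + C * ∑ y ∈ t m, ‖∫ z, u z ∂(unifBall Ω y (1 / (m + 1)))‖ₑ := by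
  have hΩt : volume Ω < ∞ := hb.measure_lt_top
  set V : ℝ≥0 := (volume Ω).toNNReal with hV
  have hVc : (V : ℝ≥0∞) = volume Ω := ENNReal.coe_toNNReal hΩt.ne
  set C₁ : ℝ≥0 := (2 ^ (N + σ * p) / c) ^ (1 / p) with hC₁
  obtain ⟨C, hC⟩ := h (ε / 2) (half_pos hε)
  obtain ⟨η, hη0, hη1, hηε⟩ := exists_mul_rpow_le (D := C * C₁ * (V + 1)) (half_pos hε) hσ
  obtain ⟨m, hm⟩ := exists_nat_one_div_lt hη0
  refine ⟨m, C * V, fun u hu hui hE => ?_⟩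
  have hρ1 : (1 / (m + 1) : ℝ≥0) ≤ 1 := hm.le.trans hη1
  have h1 := eLpNorm_one_le_sum_avg hΩm hd hc hp hσ (by positivity) hρ1 (ht m) (hcov m) hu hui hE
  set S := ∑ y ∈ t m, ‖∫ z, u z ∂(unifBall Ω y (1 / (m + 1)))‖ₑ with hS
  rw [← hC₁, ← hVc] at h1
  calc eLpNorm u q (volume.restrict Ω) ≤ _ := hC u hu hE
    _ ≤ (ε / 2 : ℝ≥0) + C * ((C₁ * (1 / (m + 1)) ^ σ : ℝ≥0) * (V + 1) + V * S) := by gcongr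
    _ = ((ε / 2 : ℝ≥0) + (C * C₁ * (V + 1) * (1 / (m + 1)) ^ σ : ℝ≥0)) + (C * V : ℝ≥0) * S := by
        push_cast; ring
    _ ≤ ((ε / 2 : ℝ≥0) + (ε / 2 : ℝ≥0)) + (C * V : ℝ≥0) * S := by
        gcongr
        refine le_trans ?_ hηε
        gcongr
    _ = _ := by rw [← ENNReal.coe_add, add_halves]

/-- A countable product of compact intervals is compact and first countable, hence sequentially
compact. -/
theorem exists_diagonal_subseq {ι : Type*} [Countable ι] (A : ℕ → ι → ℝ)
    (hA : ∀ i, ∃ B : ℝ, ∀ n, |A n i| ≤ B) :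
    ∃ k : ℕ → ℕ, StrictMono k ∧ ∀ i, ∃ l, Tendsto (fun n => A (k n) i) atTop (𝓝 l) := by
  choose B hB using hA
  have hc : IsCompact (Set.pi univ fun i => Icc (-B i) (B i)) :=
    isCompact_univ_pi fun i => isCompact_Icc
  obtain ⟨l, -, k, hk, hl⟩ := hc.tendsto_subseq (x := A) fun n i _ => abs_le.1 (hB i n)
  exact ⟨k, hk, fun i => ⟨l i, (tendsto_pi_nhds.1 hl) i⟩⟩

/-- A sequence that is bounded in `L^1` and has Gagliardo differences of energy at most `1` has a
subsequence which converges in every `L^q` for which the Ehrling inequality is available. -/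
theorem Ehrling.exists_subseq_tendsto (hΩm : MeasurableSet Ω) (hb : Bornology.IsBounded Ω)
    (hd : MeasureDensity Ω c) (hc : 0 < c) (hp : 1 ≤ p) (hσ : 0 < σ) {q : ℝ≥0∞} (hq : 1 ≤ q)
    (h : Ehrling Ω p σ q) {u : ℕ → E N → ℝ} (hu : ∀ n, Measurable (u n)) {K : ℝ≥0}
    (hK : ∀ n, eLpNorm (u n) 1 (volume.restrict Ω) ≤ K)
    (huq : ∀ n, MemLp (u n) q (volume.restrict Ω))
    (hE : ∀ n m, gagEnergy Ω p σ (u n - u m) ≤ 1) :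
    ∃ (v : E N → ℝ) (k : ℕ → ℕ), MemLp v q (volume.restrict Ω) ∧ StrictMono k ∧
      Tendsto (fun n => eLpNorm (u (k n) - v) q (volume.restrict Ω)) atTop (𝓝 0) := by
  have hint : ∀ n, IntegrableOn (u n) Ω := fun n =>
    memLp_one_iff_integrable.1 ⟨(hu n).aestronglyMeasurable, (hK n).trans_lt ENNReal.coe_lt_top⟩
  have hρ0 : ∀ m : ℕ, (0 : ℝ≥0) < 1 / (m + 1) := fun m => by positivity
  have hρ1 : ∀ m : ℕ, (1 / (m + 1) : ℝ≥0) ≤ 1 := fun m =>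
    div_le_one_of_le₀ le_add_self (zero_le)
  choose t ht hcov using fun m : ℕ =>
    exists_finite_net hb (ρ := ((1 / (m + 1) : ℝ≥0) : ℝ)) (hρ0 m)
  -- The index runs over all centres of all nets, so one subsequence serves every ε.
  let A : ℕ → (Σ m : ℕ, t m) → ℝ := fun n i => ∫ z, u n z ∂(unifBall Ω i.2 (1 / (i.1 + 1)))
  obtain ⟨k, hk, hlim⟩ := exists_diagonal_subseq A (by
    rintro ⟨m, y, hy⟩
    set B : ℝ≥0 := c ^ (-(1 / (1 : ℝ))) * (1 / (m + 1)) ^ (-(N / (1 : ℝ))) * K with hB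
    refine ⟨B, fun n => ?_⟩
    have h1 := lintegral_unifBall_enorm_le hd hc (hu n) (ht m y hy) (hρ0 m) (hρ1 m) le_rfl
    rw [ENNReal.ofReal_one] at h1
    have h2 : ‖∫ z, u n z ∂(unifBall Ω y (1 / (m + 1)))‖ₑ ≤ B := by
      refine (enorm_integral_le_lintegral_enorm _).trans (h1.trans ?_)
      rw [hB, ENNReal.coe_mul _ K]
      gcongr
      exact hK n
    rw [enorm_le_coe, ← NNReal.coe_le_coe, coe_nnnorm, Real.norm_eq_abs] at h2
    exact h2)
  have : Fact (1 ≤ q) := ⟨hq⟩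
  have hcauchy : CauchySeq fun n => (huq (k n)).toLp (u (k n)) := by
    rw [EMetric.cauchySeq_iff]
    intro ε hε
    obtain ⟨δ, hδ0, hδ⟩ := ENNReal.lt_iff_exists_nnreal_btwn.1 hε
    have hδ0' : 0 < δ := by exact_mod_cast hδ0
    obtain ⟨m, C, hC⟩ := h.exists_sum_avg hΩm hb hd hc hp hσ ht hcov (half_pos hδ0')
    have hten : Tendsto (fun ab : ℕ × ℕ => (C : ℝ≥0∞) * ∑ y : t m,
        ‖A (k ab.1) ⟨m, y⟩ - A (k ab.2) ⟨m, y⟩‖ₑ) atTop (𝓝 (C * ∑ y : t m, ‖(0 : ℝ)‖ₑ)) := by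
      refine ENNReal.Tendsto.const_mul (tendsto_finsetSum _ fun y _ => ?_)
        (Or.inr ENNReal.coe_ne_top)
      obtain ⟨l, hl⟩ := hlim ⟨m, y⟩
      rw [← prod_atTop_atTop_eq, ← sub_self l]
      exact ((hl.comp tendsto_fst).sub (hl.comp tendsto_snd)).enorm
    simp only [enorm_zero, Finset.sum_const_zero, mul_zero] at hten
    have hev := hten.eventually (gt_mem_nhds (show (0 : ℝ≥0∞) < (δ / 2 : ℝ≥0) by
      exact_mod_cast half_pos hδ0'))
    obtain ⟨n₀, hn₀⟩ := eventually_atTop_prod_self'.1 hev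
    refine ⟨n₀, fun a ha b hb' => ?_⟩
    rw [Lp.edist_toLp_toLp]
    have h1 := hC (u (k a) - u (k b)) ((hu _).sub (hu _)) ((hint _).sub (hint _)) (hE _ _)
    have h2 : ∑ y ∈ t m, ‖∫ z, (u (k a) - u (k b)) z ∂(unifBall Ω y (1 / (m + 1)))‖ₑ =
        ∑ y : t m, ‖A (k a) ⟨m, y⟩ - A (k b) ⟨m, y⟩‖ₑ := by
      rw [← Finset.sum_coe_sort]
      refine Finset.sum_congr rfl fun y _ => ?_
      have h0 := hd.measure_ne_zero hc (ht m y y.2) (hρ0 m) (hρ1 m)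
      simp only [Pi.sub_apply, A]
      rw [integral_sub (integrable_unifBall (hint _) h0) (integrable_unifBall (hint _) h0)]
    rw [h2] at h1
    calc _ ≤ _ := h1
      _ ≤ ((δ / 2 : ℝ≥0) : ℝ≥0∞) + (δ / 2 : ℝ≥0) := by
          gcongr
          exact (hn₀ a ha b hb').le
      _ = δ := by rw [← ENNReal.coe_add, add_halves]
      _ < ε := hδ
  obtain ⟨v, hv⟩ := cauchySeq_tendsto_of_complete hcauchy
  refine ⟨v, k, Lp.memLp v, hk, ?_⟩
  rw [Lp.tendsto_Lp_iff_tendsto_eLpNorm'] at hv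
  refine hv.congr fun n => eLpNorm_congr_ae ?_
  filter_upwards [(huq (k n)).coeFn_toLp] with x hx
  simp [hx]


/-! ### Rescaling energies and transfer to the Musielak-Sobolev space. -/

theorem gagEnergy_congr {u v : E N → ℝ} (h : u =ᵐ[volume.restrict Ω] v) :
    gagEnergy Ω p σ u = gagEnergy Ω p σ v := by
  refine lintegral_congr_ae ?_
  filter_upwards [h] with x hx
  refine lintegral_congr_ae ?_
  filter_upwards [h] with y hy
  simp only [gagKernel, hx, hy]

theorem gagEnergy_sub_div_le (hp : 1 ≤ p) {u v : E N → ℝ} (hu : Measurable u)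
    (L : ℝ) : gagEnergy Ω p σ (fun x => (u x - v x) / L) ≤
      ‖L⁻¹‖ₑ ^ p * (2 ^ (p - 1) * (gagEnergy Ω p σ u + gagEnergy Ω p σ v)) := by
  have hp0 : 0 ≤ p := by linarith
  have h2 : (2 : ℝ≥0∞) ^ (p - 1) ≠ ∞ :=
    ENNReal.rpow_ne_top_of_nonneg (by linarith) ENNReal.ofNat_ne_top
  have hL : ‖L⁻¹‖ₑ ^ p ≠ ∞ := ENNReal.rpow_ne_top_of_nonneg hp0 enorm_ne_top
  set B := ‖L⁻¹‖ₑ ^ p * 2 ^ (p - 1) with hB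
  have hBt : B ≠ ∞ := ENNReal.mul_ne_top hL h2
  have hk : ∀ x y, gagKernel p σ (fun x => (u x - v x) / L) x y ≤
      B * (gagKernel p σ u x y + gagKernel p σ v x y) := by
    intro x y
    simp only [gagKernel]
    rw [← ENNReal.add_div, ← mul_div_assoc]
    gcongr
    have h1 : (u x - v x) / L - (u y - v y) / L = L⁻¹ * ((u x - u y) - (v x - v y)) := by ring
    rw [h1, enorm_mul, ENNReal.mul_rpow_of_nonneg _ _ hp0, hB, mul_assoc]
    gcongr
    exact (ENNReal.rpow_le_rpow (enorm_sub_le) hp0).trans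
      (ENNReal.rpow_add_le_mul_rpow_add_rpow _ _ hp)
  rw [← mul_assoc, ← hB]
  calc gagEnergy Ω p σ (fun x => (u x - v x) / L)
      ≤ ∫⁻ x in Ω, ∫⁻ y in Ω, B * (gagKernel p σ u x y + gagKernel p σ v x y) :=
        lintegral_mono fun x => lintegral_mono fun y => hk x y
    _ = B * (gagEnergy Ω p σ u + gagEnergy Ω p σ v) := by
        simp_rw [lintegral_const_mul' _ _ hBt]
        congr 1
        rw [gagEnergy, gagEnergy, ← lintegral_add_left (measurable_gagDensity hu)]
        refine lintegral_congr fun x => ?_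
        have hm : Measurable fun y => gagKernel p σ u x y :=
          (measurable_gagKernel hu).comp measurable_prodMk_left
        rw [gagDensity, gagDensity, ← lintegral_add_left hm]

/-- The Ehrling inequality needs energy at most 1, whereas differences of normalised functions only
have bounded energy; one fixed dilation repairs this for all pairs. -/
theorem exists_scale (hp : 1 ≤ p) (K : ℝ≥0) : ∃ L : ℝ, 1 ≤ L ∧
    ‖L⁻¹‖ₑ ^ p * (2 ^ (p - 1) * (K + K)) ≤ 1 := by
  set M : ℝ≥0 := 2 ^ (p - 1) * (K + K) with hM
  have hMc : ((M : ℝ≥0) : ℝ≥0∞) = 2 ^ (p - 1) * (K + K) := by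
    rw [hM, ENNReal.coe_mul, ENNReal.coe_rpow_of_nonneg _ (by linarith)]; push_cast; rfl
  refine ⟨1 + M, by simp, ?_⟩
  rw [← hMc]
  have h1 : ‖(1 + (M : ℝ))⁻¹‖ₑ = ((1 + M)⁻¹ : ℝ≥0) := by
    rw [Real.enorm_eq_ofReal (by positivity), ← ENNReal.ofReal_coe_nnreal]
    push_cast
    rfl
  rw [h1, ← ENNReal.coe_rpow_of_nonneg _ (by linarith), ← ENNReal.coe_mul, ENNReal.coe_le_one_iff]
  have h2 : (1 + M)⁻¹ ≤ 1 := inv_le_one_of_one_le₀ le_self_add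
  calc ((1 + M)⁻¹) ^ p * M ≤ ((1 + M)⁻¹) ^ (1 : ℝ) * M := by
        gcongr ?_ * M
        exact NNReal.rpow_le_rpow_of_exponent_ge (by positivity) h2 hp
    _ ≤ 1 := by
        rw [NNReal.rpow_one, inv_mul_le_iff₀ (by positivity), mul_one]
        exact le_add_self

variable {a : E N → E N → ℝ → ℝ}

/-- The Ehrling inequality for the classical Gagliardo energy with exponents `φ⁻` and `σ < s`
implies the compact embedding of the fractional Musielak-Sobolev space. -/
theorem compactlyEmbedded_of_ehrling (hN : 1 ≤ N) (hΩo : IsOpen Ω) (hb : Bornology.IsBounded Ω)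
    (hd : MeasureDensity Ω c) (hc : 0 < c) {s : ℝ} (hσ : 0 < σ) (hσs : σ < s)
    (ha : IsMusielak Ω a) (hg : GrowthCondition Ω a)
    (hpos : ∃ b : ℝ, 0 < b ∧ ∀ x ∈ Ω, ∀ y ∈ Ω, b ≤ Phi a x y 1) {q : ℝ≥0∞} (hq : 1 ≤ q)
    (h : Ehrling Ω (phiMinus Ω a) σ q) : CompactlyEmbedded Ω a s q := by
  have hΩm := hΩo.measurableSet
  set p := phiMinus Ω a with hpdef
  have hp : 1 ≤ p := hg.1.le
  have hp0 : 0 < p := by linarith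
  obtain ⟨b, hb0, hbΦ⟩ := hpos
  obtain ⟨K, hK⟩ := exists_energy_bound hN hb hσs hΩm ha hg hb0 hbΦ
  obtain ⟨L, hL1, hLE⟩ := exists_scale hp K
  have hL0 : 0 < L := by linarith
  obtain ⟨C, hC⟩ := h 1 one_pos
  have hLinv : ‖L⁻¹‖ₑ ≤ 1 := by
    rw [Real.enorm_eq_ofReal (by positivity), ENNReal.ofReal_le_one]
    exact inv_le_one_of_one_le₀ hL1
  -- normalized measurable representatives
  have hrep : ∀ u : E N → ℝ, MemW Ω a s u → ∀ r : ℝ, normW Ω a s u < r →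
      ∃ w : E N → ℝ, Measurable w ∧ (fun x => r * w x) =ᵐ[volume.restrict Ω] u ∧
        eLpNorm w 1 (volume.restrict Ω) ≤ K ∧ gagEnergy Ω p σ w ≤ K := by
    intro u hu r hr
    have hr0 : r ≠ 0 := ((normW_nonneg s u).trans_lt hr).ne'
    obtain ⟨h1, h2⟩ := hu.modulars_le_one hΩm ha hr
    obtain ⟨h3, h4⟩ := hK _ h1 h2
    have hae : (fun x => u x / r) =ᵐ[volume.restrict Ω] fun x => hu.1.mk u x / r := by
      filter_upwards [hu.1.ae_eq_mk] with x hx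
      rw [← hx]
    refine ⟨fun x => hu.1.mk u x / r, hu.1.stronglyMeasurable_mk.measurable.div_const r, ?_,
      (eLpNorm_congr_ae hae).symm.trans_le h3, (gagEnergy_congr hae).symm.trans_le h4⟩
    filter_upwards [hu.1.ae_eq_mk] with x hx
    rw [mul_div_cancel₀ _ hr0, hx]
  have hscale : ∀ w : E N → ℝ, Measurable w → eLpNorm w 1 (volume.restrict Ω) ≤ K →
      gagEnergy Ω p σ w ≤ K →
      eLpNorm (fun x => w x / L) 1 (volume.restrict Ω) ≤ K ∧
      eLpNorm (fun x => w x / L) q (volume.restrict Ω) ≤ (1 + C * K : ℝ≥0) := by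
    intro w hw hw1 hwE
    have h1 : eLpNorm (fun x => w x / L) 1 (volume.restrict Ω) ≤ K := by
      have : (fun x => w x / L) = L⁻¹ • w := by
        ext x; simp [div_eq_inv_mul]
      rw [this, eLpNorm_const_smul]
      exact (mul_le_of_le_one_left' hLinv).trans hw1
    refine ⟨h1, ?_⟩
    have h2 := gagEnergy_sub_div_le (Ω := Ω) (σ := σ) (v := 0) hp hw L
    have h0 : gagEnergy Ω p σ (0 : E N → ℝ) = 0 := by
      simp [gagEnergy, gagDensity, gagKernel, hp0]
    simp only [Pi.zero_apply, sub_zero, h0] at h2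
    have h3 : gagEnergy Ω p σ (fun x => w x / L) ≤ 1 := by
      refine h2.trans (le_trans ?_ hLE)
      gcongr
      exact zero_le
    refine (hC _ (hw.div_const L) h3).trans ?_
    push_cast
    gcongr
  have hcont : ContinuouslyEmbedded Ω a s q := by
    refine ⟨L * (1 + C * K), by positivity, fun u hu => ?_⟩
    -- Normalisation is possible only strictly above the norm; letting r decrease to it recovers the
    -- sharp factor, also when the norm is zero.
    have hbound : ∀ r : ℝ, normW Ω a s u < r →
        eLpNorm u q (volume.restrict Ω) ≤ ENNReal.ofReal (L * (1 + C * K) * r) := by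
      intro r hr
      have hr0 : 0 < r := (normW_nonneg s u).trans_lt hr
      obtain ⟨w, hw, hwu, hw1, hwE⟩ := hrep u hu r hr
      obtain ⟨-, h2⟩ := hscale w hw hw1 hwE
      have h3 : (fun x => r * w x) = (r * L) • fun x => w x / L := by
        ext x; simp only [Pi.smul_apply, smul_eq_mul]; field_simp
      rw [← eLpNorm_congr_ae hwu, h3, eLpNorm_const_smul, Real.enorm_eq_ofReal (by positivity)]
      calc ENNReal.ofReal (r * L) * _ ≤ ENNReal.ofReal (r * L) * (1 + C * K : ℝ≥0) := by gcongr
        _ = _ := by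
            rw [← ENNReal.ofReal_coe_nnreal, ← ENNReal.ofReal_mul (by positivity)]
            push_cast
            congr 1; ring
    have hlim : Tendsto (fun r : ℝ => ENNReal.ofReal (L * (1 + C * K) * r))
        (𝓝[>] (normW Ω a s u)) (𝓝 (ENNReal.ofReal (L * (1 + C * K) * normW Ω a s u))) :=
      ((ENNReal.continuous_ofReal.comp (continuous_const.mul continuous_id)).tendsto _).mono_left
        nhdsWithin_le_nhds
    have hle := ge_of_tendsto hlim (eventually_nhdsWithin_of_forall hbound)
    exact ⟨⟨hu.1, hle.trans_lt ENNReal.ofReal_lt_top⟩, hle⟩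
  refine ⟨hcont, fun u hu ⟨R, hR⟩ => ?_⟩
  -- A common factor R + 1, strictly above all the norms, lets convergence of the rescaled functions
  -- pass back to the original sequence.
  have hr0 : 0 < R + 1 := by linarith [normW_nonneg (Ω := Ω) (a := a) s (u 0), hR 0]
  choose w hw hwu hw1 hwE using fun n => hrep (u n) (hu n) (R + 1) (by linarith [hR n])
  obtain ⟨v, k, hv, hk, hlim⟩ := h.exists_subseq_tendsto hΩm hb hd hc hp hσ hq
    (u := fun n x => w n x / L) (fun n => (hw n).div_const L)
    (fun n => (hscale _ (hw n) (hw1 n) (hwE n)).1)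
    (fun n => ⟨((hw n).div_const L).aestronglyMeasurable,
      (hscale _ (hw n) (hw1 n) (hwE n)).2.trans_lt ENNReal.coe_lt_top⟩)
    (fun n m => by
      have h1 : ((fun x => w n x / L) - fun x => w m x / L) = fun x => (w n x - w m x) / L := by
        ext x; simp [sub_div]
      rw [h1]
      refine (gagEnergy_sub_div_le hp (hw n) L).trans (le_trans ?_ hLE)
      gcongr
      · exact hwE n
      · exact hwE m)
  refine ⟨((R + 1) * L) • v, k, hv.const_smul _, hk, ?_⟩
  have heq : ∀ n, eLpNorm (fun x => u (k n) x - (((R + 1) * L) • v) x) q (volume.restrict Ω) =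
      ‖(R + 1) * L‖ₑ * eLpNorm ((fun x => w (k n) x / L) - v) q (volume.restrict Ω) := by
    intro n
    rw [← eLpNorm_const_smul]
    refine eLpNorm_congr_ae ?_
    filter_upwards [hwu (k n)] with x hx
    simp only [← hx, Pi.smul_apply, Pi.sub_apply, smul_eq_mul]
    field_simp
  simp_rw [heq]
  simpa using ENNReal.Tendsto.const_mul hlim (Or.inr (enorm_ne_top (x := (R + 1) * L)))

end FracMusielak

end

/-! ### Choice of σ in the three regimes. -/

theorem corollary3p1 (N : ℕ) (hN : 1 ≤ N) (Ω : Set (FracMusielak.E N))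
    (hΩ_open : IsOpen Ω) (hΩ_bdd : Bornology.IsBounded Ω)
    (hΩ_lip : FracMusielak.IsLipschitzDomain Ω)
    (s s' : ℝ) (hs' : 0 < s') (hs's : s' < s) (hs : s < 1)
    (a : FracMusielak.E N → FracMusielak.E N → ℝ → ℝ)
    (ha : FracMusielak.IsMusielak Ω a)
    (hPhi1 : FracMusielak.GrowthCondition Ω a)
    (hpos : ∃ c : ℝ, 0 < c ∧ ∀ x ∈ Ω, ∀ y ∈ Ω, c ≤ FracMusielak.Phi a x y 1) :
    (s' * FracMusielak.phiMinus Ω a < N →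
      (∀ q : ℝ≥0∞, 1 ≤ q → q ≤ FracMusielak.critExp Ω a s' →
        FracMusielak.ContinuouslyEmbedded Ω a s q) ∧
      (∀ q : ℝ≥0∞, 1 ≤ q → q < FracMusielak.critExp Ω a s' →
        FracMusielak.CompactlyEmbedded Ω a s q)) ∧
    (s' * FracMusielak.phiMinus Ω a = N →
      (∀ q : ℝ≥0∞, 1 ≤ q → FracMusielak.ContinuouslyEmbedded Ω a s q) ∧
      (∀ q : ℝ≥0∞, 1 ≤ q → q < ∞ → FracMusielak.CompactlyEmbedded Ω a s q)) ∧
    ((N : ℝ) < s' * FracMusielak.phiMinus Ω a →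
      FracMusielak.CompactlyEmbedded Ω a s ∞) := by
  obtain ⟨c, hc, hd⟩ := hΩ_lip.exists_measure_density hΩ_open hΩ_bdd
  have hΩm := hΩ_open.measurableSet
  set p := FracMusielak.phiMinus Ω a with hp
  have hp1 : 1 ≤ p := hPhi1.1.le
  have hp0 : 0 < p := by linarith
  have hcompact : ∀ {σ : ℝ}, 0 < σ → σ < s → ∀ {q : ℝ≥0∞}, 1 ≤ q → FracMusielak.Ehrling Ω p σ q →
      FracMusielak.CompactlyEmbedded Ω a s q := fun hσ hσs _ hq h =>
    FracMusielak.compactlyEmbedded_of_ehrling hN hΩ_open hΩ_bdd hd hc hσ hσs ha hPhi1 hpos hq h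
  refine ⟨fun hlt => ?_, fun heq => ?_, fun hgt => ?_⟩
  · have hall : ∀ q : ℝ≥0∞, 1 ≤ q → q ≤ FracMusielak.critExp Ω a s' →
        FracMusielak.CompactlyEmbedded Ω a s q := by
      intro q hq hqc
      rw [FracMusielak.critExp, if_pos hlt, ← hp] at hqc
      -- σ > s' pushes the critical exponent strictly beyond `critExp Ω a s'`, while σ < N/p keeps
      -- it finite.
      obtain ⟨σ, hσ1, hσ2⟩ := exists_between (lt_min hs's ((lt_div_iff₀ hp0).2 hlt))
      have hσp : σ * p < N := (lt_div_iff₀ hp0).1 (hσ2.trans_le (min_le_right _ _))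
      have hN0 : (0 : ℝ) < N := by exact_mod_cast hN
      have hexp : N * p / (N - s' * p) < N * p / (N - σ * p) := by
        refine div_lt_div_of_pos_left (by positivity) (by linarith) ?_
        have := mul_lt_mul_of_pos_right hσ1 hp0
        linarith
      exact hcompact (hs'.trans hσ1) (hσ2.trans_le (min_le_left _ _)) hq
        ((FracMusielak.ehrling_of_lt_critical hN hΩm hΩ_bdd hd hc hp1 (hs'.trans hσ1) hσp
          hexp).of_le hΩ_bdd hqc)
    exact ⟨fun q hq hqc => (hall q hq hqc).1, fun q hq hqc => hall q hq hqc.le⟩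
  · have hall : ∀ q : ℝ≥0∞, 1 ≤ q → FracMusielak.CompactlyEmbedded Ω a s q := by
      intro q hq
      -- Any increase of the order beyond s' leads into Morrey's regime, which yields every exponent
      -- including ∞.
      obtain ⟨σ, hσ1, hσ2⟩ := exists_between hs's
      have hσp : N < σ * p := heq ▸ mul_lt_mul_of_pos_right hσ1 hp0
      exact hcompact (hs'.trans hσ1) hσ2 hq
        ((FracMusielak.ehrling_top hΩm hd hc hp1 (hs'.trans hσ1) hσp).of_le hΩ_bdd le_top)
    exact ⟨fun q hq => (hall q hq).1, fun q hq _ => hall q hq⟩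
  · exact hcompact hs' hs's le_top (FracMusielak.ehrling_top hΩm hd hc hp1 hs' hgt)
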